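/- Let $G=(V,E)$ be a directed acyclic graph with a root $r\in V$ from which every vertex can be reached, a set $T\subseteq V\setminus\{r\}$ of $K\ge 2$ terminals, positive integer capacities $c(e)$ and nonnegative rational lengths $\ell(e)$ on the arcs $e\in E$. A feasible solution is a directed tree $S$ in $G$, rooted at $r$ and spanning all terminals, such that for every arc $e=(u,v)$ of $S$ the subtree of $S$ rooted at $v$ contains at most $c(e)$ terminals. CAP-STEINER-TREE asks whether a feasible solution exists; ML-CAP-STEINER-TREE asks for a feasible solution of minimum total length, if one exists; STEINER-TREE asks for a directed tree of minimum total length in $G$, rooted at $r$ and spanning all terminals, without capacity constraints. For every constant $\kappa\ge 0$, the following holds on the instances in which $G$ is a directed acyclic graph and $c(e)\ge K-\kappa$ for all $e\in E$. 1. CAP-STEINER-TREE is solvable in polynomial time. 2. ML-CAP-STEINER-TREE can be approximated in polynomial time within a ratio of $1+\rho$, where $\rho\ge 1$ is any ratio (a constant, or a function of the STEINER-TREE instance) within which STEINER-TREE can be approximated in polynomial time on directed acyclic graphs. That is, there is a polynomial-time algorithm that either returns a feasible solution of length at most $1+\rho$ times that of every feasible solution or, exactly when there is none, reports that no feasible solution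 exists. -/

import Mathlib

/-! ### A cost model for algorithms

Data are binary trees. Programs form a first-order list-processing language with conditionals and
while loops. Every elementary operation costs one unit plus the size of the data it handles, so
that polynomial time for this cost is polynomial time on Turing machines: a tree is stored as a
word of proportional length, and conversely the tapes of a Turing machine are stored as lists. -/

namespace CapSteiner

/-- Binary trees, the data handled by programs. -/
inductive Data : Type
  | nil : Data
  | cons : Data → Data → Data

namespace Data

/-- The number of nodes of a binary tree, leaves included. -/
def size : Data → ℕ
  | nil => 1
  | cons a b => a.size + b.size + 1

/-- The first component, with the convention that it is `nil` for `nil`. -/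
def head : Data → Data
  | nil => nil
  | cons a _ => a

/-- The second component, with the convention that it is `nil` for `nil`. -/
def tail : Data → Data
  | nil => nil
  | cons _ b => b

end Data

/-- Programs. Each one takes one tree as its input and returns one tree, if it halts. -/
inductive Prog : Type
  /-- return the input -/
  | id : Prog
  /-- return the constant `nil` -/
  | nil : Prog
  /-- return the first component of the input -/
  | head : Prog
  /-- return the second component of the input -/
  | tail : Prog
  /-- run both programs on the input and pair their results -/
  | cons : Prog → Prog → Prog
  /-- run the first program, then run the second one on its result -/
  | seq : Prog → Prog → Prog
  /-- `ite c p q`: if `c` does not return `nil` on the input, run `p` on the input, else run `q` -/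
  | ite : Prog → Prog → Prog → Prog
  /-- `loop c p`: while `c` does not return `nil` on the current tree, replace this tree by the
  result of `p` on it -/
  | loop : Prog → Prog → Prog

/-- `Runs p x y t`: on input `x`, the program `p` halts with output `y`, at total cost `t`. -/
inductive Runs : Prog → Data → Data → ℕ → Prop
  | id (x : Data) : Runs Prog.id x x (x.size + 1)
  | nil (x : Data) : Runs Prog.nil x Data.nil (x.size + 1)
  | head (x : Data) : Runs Prog.head x x.head (x.size + 1)
  | tail (x : Data) : Runs Prog.tail x x.tail (x.size + 1)
  | cons {p q : Prog} {x y z : Data} {s t : ℕ} :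
      Runs p x y s → Runs q x z t →
      Runs (Prog.cons p q) x (Data.cons y z) (s + t + (Data.cons y z).size + 1)
  | seq {p q : Prog} {x y z : Data} {s t : ℕ} :
      Runs p x y s → Runs q y z t → Runs (Prog.seq p q) x z (s + t + 1)
  | ite_true {c p q : Prog} {x a b y : Data} {s t : ℕ} :
      Runs c x (Data.cons a b) s → Runs p x y t → Runs (Prog.ite c p q) x y (s + t + 1)
  | ite_false {c p q : Prog} {x y : Data} {s t : ℕ} :
      Runs c x Data.nil s → Runs q x y t → Runs (Prog.ite c p q) x y (s + t + 1)
  | loop_stop {c p : Prog} {x : Data} {s : ℕ} :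
      Runs c x Data.nil s → Runs (Prog.loop c p) x x (s + 1)
  | loop_step {c p : Prog} {x a b y z : Data} {s t u : ℕ} :
      Runs c x (Data.cons a b) s → Runs p x y t → Runs (Prog.loop c p) y z u →
      Runs (Prog.loop c p) x z (s + t + u + 1)

/-- The computational problem on inputs `a : α` in the class `C`, encoded by `enc`, with
`Correct a y` expressing that `y` is a correct output for `a`, is solvable in polynomial time:
a single program halts with a correct output on every input in the class, at a cost that is at
most a fixed polynomial in the size of the encoded input. -/
def PolyTimeSolvable {α : Type} (enc : α → Data) (C : α → Prop) (Correct : α → Data → Prop) :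
    Prop :=
  ∃ (p : Prog) (P : Polynomial ℕ), ∀ a : α, C a →
    ∃ (y : Data) (t : ℕ), Runs p (enc a) y t ∧ t ≤ P.eval (enc a).size ∧ Correct a y

/-! ### Encodings -/

/-- A truth value. -/
def encBool (b : Bool) : Data := if b then Data.cons Data.nil Data.nil else Data.nil

/-- A finite list. -/
def encList (l : List Data) : Data := l.foldr Data.cons Data.nil

/-- A natural number in binary, least significant bit first. -/
def encNat (m : ℕ) : Data := encList (m.bits.map encBool)

/-- A nonnegative rational number, as the pair of its numerator and its denominator in binary. -/
def encRat (q : ℚ≥0) : Data := Data.cons (encNat q.num) (encNat q.den)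

/-- A vector of length `n`. -/
def encVec {n : ℕ} (f : Fin n → Data) : Data := encList (List.ofFn f)

/-- A set of vertices, as a `0-1` vector. -/
def encSet {n : ℕ} (s : Finset (Fin n)) : Data := encVec fun v => encBool (decide (v ∈ s))

/-- A set of arcs, as a `0-1` matrix. -/
def encArcs {n : ℕ} (S : Finset (Fin n × Fin n)) : Data :=
  encVec fun u => encVec fun v => encBool (decide ((u, v) ∈ S))

open Classical in
/-- A digraph with data `w u v` on its arcs, as a matrix with entry `nil` where there is no arc. -/
noncomputable def encDigraph {n : ℕ} (G : Digraph (Fin n)) (w : Fin n → Fin n → Data) : Data :=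
  encVec fun u => encVec fun v => if G.Adj u v then Data.cons (w u v) Data.nil else Data.nil

/-! ### The instances -/

/-- A digraph with a root from which every vertex can be reached, and a set of at least two
terminals that does not contain the root. -/
structure RootedNetwork where
  /-- the number of vertices -/
  n : ℕ
  /-- the digraph -/
  G : Digraph (Fin n)
  /-- the root -/
  root : Fin n
  /-- the set of terminals -/
  terminals : Finset (Fin n)
  root_notMem : root ∉ terminals
  two_le_card : 2 ≤ terminals.card
  reach : ∀ v, Relation.ReflTransGen G.Adj root v

/-- An instance of STEINER-TREE: a nonnegative rational length on each arc. (Only the values at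
the arcs of the digraph matter, here and for the capacities below.) -/
structure SteinerInstance extends RootedNetwork where
  /-- the length of an arc -/
  len : Fin n → Fin n → ℚ≥0

/-- An instance of CAP-STEINER-TREE: a positive integral capacity on each arc. -/
structure CapInstance extends RootedNetwork where
  /-- the capacity of an arc -/
  cap : Fin n → Fin n → ℕ
  cap_pos : ∀ u v, G.Adj u v → 0 < cap u v

/-- An instance of ML-CAP-STEINER-TREE: both capacities and lengths. -/
structure MLCapInstance extends CapInstance, SteinerInstance

namespace RootedNetwork

/-- The digraph has no directed circuit. -/
def IsDAG (I : RootedNetwork) : Prop := ∀ v, ¬ Relation.TransGen I.G.Adj v v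

/-- There is a directed path from `u` to `v` all of whose arcs are in `S`. -/
def Linked {n : ℕ} (S : Finset (Fin n × Fin n)) (u v : Fin n) : Prop :=
  Relation.ReflTransGen (fun a b => (a, b) ∈ S) u v

/-- `S` is the arc set of a directed tree in the digraph, rooted at the root: no arc enters the
root, at most one arc enters any other vertex, and every arc can be reached from the root. -/
structure IsTree (I : RootedNetwork) (S : Finset (Fin I.n × Fin I.n)) : Prop where
  adj : ∀ a ∈ S, I.G.Adj a.1 a.2
  root_no_entry : ∀ a ∈ S, a.2 ≠ I.root
  unique_entry : ∀ a ∈ S, ∀ b ∈ S, a.2 = b.2 → a = b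
  linked : ∀ a ∈ S, Linked S I.root a.1

/-- `S` is the arc set of a directed tree rooted at the root and spanning all terminals. -/
def IsSteinerTree (I : RootedNetwork) (S : Finset (Fin I.n × Fin I.n)) : Prop :=
  I.IsTree S ∧ ∀ t ∈ I.terminals, Linked S I.root t

/-- The encoding of a network with data `w u v` on its arcs. -/
noncomputable def enc (I : RootedNetwork) (w : Fin I.n → Fin I.n → Data) : Data :=
  Data.cons (encDigraph I.G w) (Data.cons (encSet {I.root}) (encSet I.terminals))

end RootedNetwork

open RootedNetwork

/-- The encoding of an instance of STEINER-TREE. -/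
noncomputable def SteinerInstance.enc (I : SteinerInstance) : Data :=
  I.toRootedNetwork.enc fun u v => encRat (I.len u v)

/-- The total length of a set of arcs. -/
def SteinerInstance.length (I : SteinerInstance) (S : Finset (Fin I.n × Fin I.n)) : ℚ≥0 :=
  ∑ a ∈ S, I.len a.1 a.2

/-- The encoding of an instance of CAP-STEINER-TREE. -/
noncomputable def CapInstance.enc (I : CapInstance) : Data :=
  I.toRootedNetwork.enc fun u v => encNat (I.cap u v)

open Classical in
/-- `S` is the arc set of a feasible solution: a directed tree rooted at the root, spanning all
terminals, and such that for each of its arcs `(u, v)` the subtree rooted at `v` contains at most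
as many terminals as the capacity of `(u, v)`. -/
def CapInstance.IsFeasible (I : CapInstance) (S : Finset (Fin I.n × Fin I.n)) : Prop :=
  I.IsSteinerTree S ∧
    ∀ a ∈ S, (I.terminals.filter fun t => Linked S a.2 t).card ≤ I.cap a.1 a.2

/-- A directed acyclic graph whose minimum capacity is at least `K - κ`, where `K` is the number
of terminals. -/
def CapInstance.IsLargeCapDAG (κ : ℕ) (I : CapInstance) : Prop :=
  I.IsDAG ∧ ∀ u v, I.G.Adj u v → I.terminals.card ≤ I.cap u v + κ

/-- The encoding of an instance of ML-CAP-STEINER-TREE. -/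
noncomputable def MLCapInstance.enc (I : MLCapInstance) : Data :=
  I.toRootedNetwork.enc fun u v => Data.cons (encNat (I.cap u v)) (encRat (I.len u v))

/-! ### The problems -/

/-- CAP-STEINER-TREE, restricted to the instances in the class `C`, is solvable in polynomial time:
given an instance, decide whether it has a feasible solution. -/
def CapSteinerTreePoly (C : CapInstance → Prop) : Prop :=
  PolyTimeSolvable CapInstance.enc C fun I y =>
    ∃ b : Bool, y = encBool b ∧ (b = true ↔ ∃ S, I.IsFeasible S)

/-- STEINER-TREE, restricted to the instances in the class `C`, has a polynomial-time approximation
algorithm with ratio `ρ` (which may be constant, or depend on the instance). -/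
def SteinerTreeApprox (C : SteinerInstance → Prop) (ρ : SteinerInstance → ℝ) : Prop :=
  PolyTimeSolvable SteinerInstance.enc C fun I y =>
    ∃ S, y = encArcs S ∧ I.IsSteinerTree S ∧
      ∀ S', I.IsSteinerTree S' → (I.length S : ℝ) ≤ ρ I * (I.length S' : ℝ)

/-- ML-CAP-STEINER-TREE, restricted to the instances in the class `C`, has a polynomial-time
approximation algorithm with ratio `ρ`: it returns a feasible solution whose length is at most `ρ`
times that of any feasible solution, or reports that there is no feasible solution. -/
def MLCapSteinerTreeApprox (C : MLCapInstance → Prop) (ρ : MLCapInstance → ℝ) : Prop :=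
  PolyTimeSolvable MLCapInstance.enc C fun I y =>
    (∃ S, y = Data.cons (encArcs S) Data.nil ∧ I.IsFeasible S ∧
      ∀ S', I.IsFeasible S' → (I.length S : ℝ) ≤ ρ I * (I.length S' : ℝ)) ∨
    (y = Data.nil ∧ ¬ ∃ S, I.IsFeasible S)

end CapSteiner

/-! ### Polynomial-time computable functions -/

namespace CapSteiner

/-! Let `K` be the number of terminals. The capacity `c` of an arc asks that at least `K - c`
terminals lie outside the subtree below the arc, and here `K - c ≤ κ`. At most `κ` outside terminals
per arc therefore matter, and a small set supplies them for all arcs at once. Indeed the terminal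
sets below the arcs of a tree form a laminar family, and `exists_small_witness` finds at most `2 *
κ` terminals of which at least `min κ |T \ B|` lie outside each member `B`. With these terminals as
tokens, a feasible tree is a certificate (`CapInstance.IsFeasible.exists_certificate`): outside each
of its arcs there are already `K - c` tokens.

Conversely, take any certificate whose tokens are distinct terminals, at least `κ` of them or as
many as there are terminals. Keep its tree and add those arcs of an arbitrary Steiner tree that
enter no vertex entered by it. The tokens below an old arc do not change and no token is below a new
arc, so the union is feasible (`CapInstance.IsCertificate.isFeasible_mergeArcs`).

A shortest certificate is found by dynamic programming over lists of at most `2 * κ` token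
positions, of which there are polynomially many for fixed `κ`. In topological order the last vertex
of a tree is a leaf, and deleting it moves its tokens to its parent (`linked_insert`). This gives
`lookup_table_sound` and `lookup_table_complete`. Feasible trees being certificates, the shortest
certificate is no longer than any of them. Merging it with a `ρ`-approximate Steiner tree costs at
most `1 + ρ` times any feasible length. For the decision problem the existence of some Steiner tree
suffices.

That all this runs in polynomial time rests on closure properties of `PT`, chiefly `PT.foldl`: a
fold is polynomial as soon as its step is and its accumulators stay polynomially bounded. -/

theorem Data.one_le_size (x : Data) : 1 ≤ x.size := by cases x <;> simp [Data.size]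

theorem polynomial_eval_mono (P : Polynomial ℕ) {a b : ℕ} (h : a ≤ b) : P.eval a ≤ P.eval b := by
  rw [Polynomial.eval_eq_sum_range, Polynomial.eval_eq_sum_range]
  gcongr

/-- Every elementary operation pays for the data it handles. Hence time bounds also bound sizes,
which is what makes polynomial bounds compose. -/
theorem Runs.size_le {p : Prog} {x y : Data} {t : ℕ} (h : Runs p x y t) :
    x.size ≤ t ∧ y.size ≤ t := by
  induction h with
  | head x => cases x <;> (simp [Data.head, Data.size]; try omega)
  | tail x => cases x <;> (simp [Data.tail, Data.size]; try omega)
  | nil x => simp [Data.size]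
  | _ => omega

/-- A single program computes `Y a` from `X a` for all `a`, in polynomial time. -/
def Comp {ι : Type} (X Y : ι → Data) : Prop :=
  ∃ (p : Prog) (P : Polynomial ℕ), ∀ a, ∃ t, Runs p (X a) (Y a) t ∧ t ≤ P.eval (X a).size

namespace Comp

variable {ι : Type} {X Y Z W : ι → Data}

theorem id : Comp X X :=
  ⟨Prog.id, Polynomial.X + 1, fun a => ⟨_, Runs.id _, by simp⟩⟩

theorem nil : Comp X (fun _ => Data.nil) :=
  ⟨Prog.nil, Polynomial.X + 1, fun a => ⟨_, Runs.nil _, by simp⟩⟩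

theorem trans (h : Comp X Y) (h' : Comp Y Z) : Comp X Z := by
  obtain ⟨p, P, hp⟩ := h
  obtain ⟨q, Q, hq⟩ := h'
  refine ⟨Prog.seq p q, P + Q.comp P + 1, fun a => ?_⟩
  obtain ⟨s, hs, hs'⟩ := hp a
  obtain ⟨t, ht, ht'⟩ := hq a
  refine ⟨_, Runs.seq hs ht, ?_⟩
  have := ht'.trans (polynomial_eval_mono Q (hs.size_le.2.trans hs'))
  simp only [Polynomial.eval_add, Polynomial.eval_comp, Polynomial.eval_one]
  omega

theorem head (h : Comp X Y) : Comp X (fun a => (Y a).head) :=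
  h.trans ⟨Prog.head, Polynomial.X + 1, fun a => ⟨_, Runs.head _, by simp⟩⟩

theorem tail (h : Comp X Y) : Comp X (fun a => (Y a).tail) :=
  h.trans ⟨Prog.tail, Polynomial.X + 1, fun a => ⟨_, Runs.tail _, by simp⟩⟩

theorem cons (h : Comp X Y) (h' : Comp X Z) : Comp X (fun a => Data.cons (Y a) (Z a)) := by
  obtain ⟨p, P, hp⟩ := h
  obtain ⟨q, Q, hq⟩ := h'
  -- The factor 2 pays for the size of the resulting pair, itself bounded by the two running times.
  refine ⟨Prog.cons p q, 2 * P + 2 * Q + 2, fun a => ?_⟩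
  obtain ⟨s, hs, hs'⟩ := hp a
  obtain ⟨t, ht, ht'⟩ := hq a
  refine ⟨_, Runs.cons hs ht, ?_⟩
  have h1 := hs.size_le.2
  have h2 := ht.size_le.2
  simp only [Polynomial.eval_add, Polynomial.eval_mul, Polynomial.eval_ofNat, Data.size]
  omega

theorem const (d : Data) : Comp X (fun _ => d) := by
  induction d with
  | nil => exact nil
  | cons a b ha hb => exact ha.cons hb

/-- Each branch needs to be correct only on the indices that reach it, hence the subtypes. -/
theorem ite (h : Comp X Y)
    (h₁ : Comp (fun a : {a // Y a ≠ Data.nil} => X a) (fun a => Z a))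
    (h₂ : Comp (fun a : {a // Y a = Data.nil} => X a) (fun a => Z a)) : Comp X Z := by
  obtain ⟨c, C, hc⟩ := h
  obtain ⟨p, P, hp⟩ := h₁
  obtain ⟨q, Q, hq⟩ := h₂
  refine ⟨Prog.ite c p q, C + P + Q + 1, fun a => ?_⟩
  obtain ⟨s, hs, hs'⟩ := hc a
  simp only [Polynomial.eval_add, Polynomial.eval_one]
  cases hY : Y a with
  | nil =>
    obtain ⟨t, ht, ht'⟩ := hq ⟨a, hY⟩
    rw [hY] at hs
    refine ⟨_, Runs.ite_false hs ht, ?_⟩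
    dsimp only at ht'
    omega
  | cons b d =>
    obtain ⟨t, ht, ht'⟩ := hp ⟨a, by simp [hY]⟩
    rw [hY] at hs
    refine ⟨_, Runs.ite_true hs ht, ?_⟩
    dsimp only at ht'
    omega

/-- Families indexed by an arbitrary type, instead of functions of the input, allow restriction to a
promised class of instances and to outputs that are only chosen. -/
theorem reindex {κ : Type} (h : Comp X Y) (f : κ → ι) : Comp (X ∘ f) (Y ∘ f) := by
  obtain ⟨p, P, hp⟩ := h
  exact ⟨p, P, fun a => hp (f a)⟩

theorem congr {X' Y' : ι → Data} (h : Comp X Y) (hX : ∀ a, X a = X' a) (hY : ∀ a, Y a = Y' a) :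
    Comp X' Y' := by
  rwa [← funext hX, ← funext hY]

end Comp

/-! ### Encoded types and polynomial-time functions between them. -/

/-- Types whose elements are encoded as trees. -/
class Enc (α : Type) where
  /-- the encoding -/
  enc : α → Data

instance : Enc Unit := ⟨fun _ => Data.nil⟩
instance : Enc Bool := ⟨encBool⟩
instance {α β : Type} [Enc α] [Enc β] : Enc (α × β) :=
  ⟨fun p => Data.cons (Enc.enc p.1) (Enc.enc p.2)⟩
instance {α : Type} [Enc α] : Enc (List α) := ⟨fun l => encList (l.map Enc.enc)⟩
instance {α : Type} [Enc α] : Enc (Option α) :=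
  ⟨fun o => o.elim Data.nil fun a => Data.cons (Enc.enc a) Data.nil⟩
/-- Natural numbers are encoded in unary. -/
instance : Enc ℕ := ⟨fun n => encList (List.replicate n Data.nil)⟩

section Enc

variable {α β : Type} [Enc α] [Enc β]

/-- The size of an encoding. -/
def esize (a : α) : ℕ := (Enc.enc a).size

theorem one_le_esize (a : α) : 1 ≤ esize a := Data.one_le_size _

@[simp] theorem enc_unit (a : Unit) : Enc.enc a = Data.nil := rfl
@[simp] theorem enc_true : Enc.enc true = Data.cons Data.nil Data.nil := rfl
@[simp] theorem enc_false : Enc.enc false = Data.nil := rfl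
@[simp] theorem enc_pair (p : α × β) :
    Enc.enc p = Data.cons (Enc.enc p.1) (Enc.enc p.2) := rfl
@[simp] theorem enc_nil : Enc.enc ([] : List α) = Data.nil := rfl
@[simp] theorem enc_cons (a : α) (l : List α) :
    Enc.enc (a :: l) = Data.cons (Enc.enc a) (Enc.enc l) := rfl
@[simp] theorem enc_none : Enc.enc (none : Option α) = Data.nil := rfl
@[simp] theorem enc_some (a : α) : Enc.enc (some a) = Data.cons (Enc.enc a) Data.nil := rfl
@[simp] theorem enc_zero : Enc.enc 0 = Data.nil := rfl
@[simp] theorem enc_succ (n : ℕ) : Enc.enc (n + 1) = Data.cons Data.nil (Enc.enc n) := rfl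

@[simp] theorem esize_pair (p : α × β) : esize p = esize p.1 + esize p.2 + 1 := rfl
@[simp] theorem esize_nil : esize ([] : List α) = 1 := rfl
@[simp] theorem esize_cons (a : α) (l : List α) : esize (a :: l) = esize a + esize l + 1 := rfl
@[simp] theorem esize_none : esize (none : Option α) = 1 := rfl
@[simp] theorem esize_some (a : α) : esize (some a) = esize a + 2 := rfl
@[simp] theorem esize_nat (n : ℕ) : esize n = 2 * n + 1 := by
  induction n with
  | zero => rfl
  | succ n ih =>
    have : esize (n + 1) = 1 + esize n + 1 := rfl
    omega

theorem esize_bool (b : Bool) : esize b ≤ 3 := by cases b <;> simp [esize, Data.size]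

theorem esize_append (l l' : List α) : esize (l ++ l') + 1 = esize l + esize l' := by
  induction l with
  | nil => simp; omega
  | cons a l ih => simp; omega

theorem esize_le_of_mem {a : α} {l : List α} (h : a ∈ l) : esize a ≤ esize l := by
  induction l with
  | nil => simp at h
  | cons b l ih =>
    rcases List.mem_cons.1 h with rfl | h
    · simp; omega
    · have := ih h; simp; omega

theorem length_le_esize (l : List α) : l.length ≤ esize l := by
  induction l with
  | nil => simp
  | cons b l ih => simp; omega

theorem esize_le_of_forall {l : List α} {N : ℕ} (h : ∀ a ∈ l, esize a ≤ N) :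
    esize l ≤ l.length * (N + 1) + 1 := by
  induction l with
  | nil => simp
  | cons b l ih =>
    have := ih fun a ha => h a (List.mem_cons_of_mem _ ha)
    have := h b List.mem_cons_self
    simp only [esize_cons, List.length_cons]
    nlinarith

/-- A numerical function that is bounded by a polynomial in the size of its encoded argument. -/
def PolyBdd (g : α → ℕ) : Prop := ∃ P : Polynomial ℕ, ∀ a, g a ≤ P.eval (esize a)

/-- A function that is computable in polynomial time. -/
@[fun_prop]
def PT (f : α → β) : Prop := Comp (fun a : α => Enc.enc a) (fun a => Enc.enc (f a))

end Enc

section Basic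

variable {α β γ δ : Type} [Enc α] [Enc β] [Enc γ] [Enc δ]

namespace PolyBdd

theorem mono {g h : α → ℕ} (hh : PolyBdd h) (hgh : ∀ a, g a ≤ h a) : PolyBdd g := by
  obtain ⟨P, hP⟩ := hh
  exact ⟨P, fun a => (hgh a).trans (hP a)⟩

theorem const (c : ℕ) : PolyBdd (fun _ : α => c) := ⟨Polynomial.C c, fun a => by simp⟩

theorem add {g h : α → ℕ} (hg : PolyBdd g) (hh : PolyBdd h) : PolyBdd fun a => g a + h a := by
  obtain ⟨P, hP⟩ := hg
  obtain ⟨Q, hQ⟩ := hh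
  exact ⟨P + Q, fun a => by simpa using Nat.add_le_add (hP a) (hQ a)⟩

theorem mul {g h : α → ℕ} (hg : PolyBdd g) (hh : PolyBdd h) : PolyBdd fun a => g a * h a := by
  obtain ⟨P, hP⟩ := hg
  obtain ⟨Q, hQ⟩ := hh
  exact ⟨P * Q, fun a => by simpa using Nat.mul_le_mul (hP a) (hQ a)⟩

theorem eval {g : α → ℕ} (hg : PolyBdd g) (P : Polynomial ℕ) : PolyBdd fun a => P.eval (g a) := by
  obtain ⟨Q, hQ⟩ := hg
  exact ⟨P.comp Q, fun a => by simpa using polynomial_eval_mono P (hQ a)⟩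

theorem self : PolyBdd fun a : α => esize a := ⟨Polynomial.X, fun a => by simp⟩

end PolyBdd

/-- This supplies most of the size bounds required by `PT.foldl`. -/
theorem PT.polyBdd {f : α → β} (hf : PT f) : PolyBdd fun a => esize (f a) := by
  obtain ⟨p, P, hp⟩ := hf
  refine ⟨P, fun a => ?_⟩
  obtain ⟨t, ht, ht'⟩ := hp a
  exact ht.size_le.2.trans ht'

theorem PT.polyBdd_length {f : α → List β} (hf : PT f) : PolyBdd fun a => (f a).length :=
  hf.polyBdd.mono fun _ => length_le_esize _

theorem PT.polyBdd_nat {f : α → ℕ} (hf : PT f) : PolyBdd f :=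
  hf.polyBdd.mono fun _ => by simp; omega

namespace PT

@[fun_prop] theorem id : PT (fun a : α => a) := Comp.id

@[fun_prop] theorem const (b : β) : PT (fun _ : α => b) := Comp.const _

@[fun_prop] theorem comp {g : β → γ} {f : α → β} (hg : PT g) (hf : PT f) :
    PT (fun a => g (f a)) := Comp.trans hf (hg.reindex f)

@[fun_prop] theorem prodMk {f : α → β} {g : α → γ} (hf : PT f) (hg : PT g) :
    PT (fun a => (f a, g a)) := Comp.cons hf hg

@[fun_prop] theorem fst {f : α → β × γ} (hf : PT f) : PT (fun a => (f a).1) := Comp.head hf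

@[fun_prop] theorem snd {f : α → β × γ} (hf : PT f) : PT (fun a => (f a).2) := Comp.tail hf

@[fun_prop] theorem list_cons {f : α → β} {g : α → List β} (hf : PT f) (hg : PT g) :
    PT (fun a => f a :: g a) := Comp.cons hf hg

@[fun_prop] theorem option_some {f : α → β} (hf : PT f) : PT (fun a => some (f a)) :=
  Comp.cons hf Comp.nil

@[fun_prop] theorem list_tail {f : α → List β} (hf : PT f) : PT (fun a => (f a).tail) :=
  (Comp.tail hf).congr (fun _ => rfl) fun a => by dsimp only; cases f a <;> rfl

@[fun_prop] theorem cond {c : α → Bool} {f g : α → β} (hc : PT c) (hf : PT f) (hg : PT g) :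
    PT (fun a => bif c a then f a else g a) := by
  refine Comp.ite hc ((hf.reindex Subtype.val).congr (fun _ => rfl) ?_)
    ((hg.reindex Subtype.val).congr (fun _ => rfl) ?_)
  all_goals
    rintro ⟨a, ha⟩
    dsimp only [Function.comp_apply] at ha ⊢
    cases h : c a <;> simp_all

@[fun_prop] theorem option_elim {o : α → Option β} {g : α → γ} {f : α → β → γ} (ho : PT o)
    (hg : PT g) (hf : PT fun p : α × β => f p.1 p.2) :
    PT (fun a => (o a).elim (g a) (f a)) := by
  refine Comp.ite ho ?_ ((hg.reindex Subtype.val).congr (fun _ => rfl) ?_)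
  · refine ((Comp.id).cons (Comp.head (ho.reindex Subtype.val))).trans ?_
    have : ∀ a : {a // Enc.enc (o a) ≠ Data.nil}, ∃ b, o a = some b := by
      rintro ⟨a, ha⟩
      cases h : o a <;> simp_all
    choose b hb using this
    refine (Comp.reindex hf (fun a : {a // Enc.enc (o a) ≠ Data.nil} => ((a : α), b a))).congr
      (fun a => ?_) (fun a => ?_)
    · simp [hb, Data.head]
    · simp [hb]
  · rintro ⟨a, ha⟩
    dsimp only [Function.comp_apply] at ha ⊢
    cases h : o a <;> simp_all

@[fun_prop] theorem head? {f : α → List β} (hf : PT f) : PT (fun a => (f a).head?) := by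
  refine Comp.ite hf
    (((Comp.head (hf.reindex Subtype.val)).cons Comp.nil).congr (fun _ => rfl) ?_)
    (Comp.nil.congr (fun _ => rfl) ?_)
  all_goals
    rintro ⟨a, ha⟩
    dsimp only [Function.comp_apply] at ha ⊢
    cases h : f a <;> simp_all [Data.head]

end PT

end Basic

/-! ### Iteration along a list. -/

section Fold

variable {ε α β γ : Type} [Enc ε] [Enc α] [Enc β] [Enc γ]

/-- A loop carries the remaining list, the environment and the accumulator. A polynomial step alone
is not enough, since iteration could blow up the accumulator; the bound `B` on the value at every
prefix excludes this, so that each round costs polynomially much. -/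
theorem PT.foldl {l : ε → List α} {i : ε → β} {f : ε → β → α → β} (hl : PT l) (hi : PT i)
    (hf : PT fun p : ε × β × α => f p.1 p.2.1 p.2.2) {B : ε → ℕ} (hB : PolyBdd B)
    (h : ∀ e l₁ l₂, l e = l₁ ++ l₂ → esize (l₁.foldl (f e) (i e)) ≤ B e) :
    PT fun e => (l e).foldl (f e) (i e) := by
  have hbody : Comp
      (fun s : ε × β × α × List α => Data.cons (Enc.enc (s.2.2.1 :: s.2.2.2))
        (Data.cons (Enc.enc s.1) (Enc.enc s.2.1)))
      (fun s => Data.cons (Enc.enc s.2.2.2)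
        (Data.cons (Enc.enc s.1) (Enc.enc (f s.1 s.2.1 s.2.2.1)))) := by
    refine Comp.cons (Comp.tail (Comp.head Comp.id)) (Comp.cons (Comp.head (Comp.tail Comp.id)) ?_)
    refine Comp.trans (Y := fun s => Enc.enc (s.1, s.2.1, s.2.2.1)) ?_
      (hf.reindex fun s : ε × β × α × List α => (s.1, s.2.1, s.2.2.1))
    exact Comp.cons (Comp.head (Comp.tail Comp.id))
      (Comp.cons (Comp.tail (Comp.tail Comp.id)) (Comp.head (Comp.head Comp.id)))
  obtain ⟨q, Q, hq⟩ := hbody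
  obtain ⟨L, hL⟩ := hl.polyBdd
  obtain ⟨B', hB'⟩ := hB
  have hloop : Comp
      (fun e => Data.cons (Enc.enc (l e)) (Data.cons (Enc.enc e) (Enc.enc (i e))))
      (fun e => Data.cons Data.nil (Data.cons (Enc.enc e) (Enc.enc ((l e).foldl (f e) (i e))))) := by
    -- This bounds the size of every loop state: remaining list, accumulator, environment and the
    -- nodes joining them.
    let R : Polynomial ℕ := L + B' + Polynomial.X + 3
    -- Induction on the unprocessed suffix `l₂`; the processed prefix `l₁` determines the
    -- accumulator.
    have key : ∀ e l₂ l₁, l e = l₁ ++ l₂ → ∃ t,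
        Runs (Prog.loop Prog.head q)
          (Data.cons (Enc.enc l₂) (Data.cons (Enc.enc e) (Enc.enc (l₁.foldl (f e) (i e)))))
          (Data.cons Data.nil (Data.cons (Enc.enc e) (Enc.enc ((l e).foldl (f e) (i e))))) t ∧
        t ≤ (l₂.length + 1) * (R.eval (esize e) + Q.eval (R.eval (esize e)) + 2) := by
      intro e l₂
      induction l₂ with
      | nil =>
        intro l₁ h₁
        rw [List.append_nil] at h₁
        refine ⟨_, by rw [h₁]; exact Runs.loop_stop (Runs.head _), ?_⟩
        have h1 := h e l₁ [] (by simpa using h₁)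
        have h2 := hB' e
        simp only [esize] at h1 h2
        simp only [R, Data.size, esize, Polynomial.eval_add, Polynomial.eval_X,
            Polynomial.eval_ofNat, enc_nil, List.length_nil]
        omega
      | cons a l₂ ih =>
        intro l₁ h₁
        obtain ⟨t, ht, ht'⟩ := ih (l₁ ++ [a]) (by simp [h₁])
        obtain ⟨s, hs, hs'⟩ := hq (e, l₁.foldl (f e) (i e), a, l₂)
        rw [List.foldl_append] at ht
        have h1 := h e l₁ (a :: l₂) h₁
        have h2 := hB' e
        have h4 := hL e
        have h5 := esize_append l₁ (a :: l₂)
        have h6 := one_le_esize l₁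
        rw [← h₁] at h5
        have h7 : (Data.cons (Enc.enc (a :: l₂)) (Data.cons (Enc.enc e)
            (Enc.enc (l₁.foldl (f e) (i e))))).size ≤ R.eval (esize e) := by
          simp only [esize] at h1 h2 h4 h5 h6
          simp only [R, Data.size, esize, Polynomial.eval_add, Polynomial.eval_X,
            Polynomial.eval_ofNat]
          omega
        have h8 := polynomial_eval_mono Q h7
        have hstep := Runs.head (Data.cons (Enc.enc (a :: l₂)) (Data.cons (Enc.enc e)
            (Enc.enc (l₁.foldl (f e) (i e)))))
        refine ⟨_, Runs.loop_step (a := Enc.enc a) (b := Enc.enc l₂) hstep hs ht, ?_⟩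
        dsimp only at hs'
        simp only [List.length_cons] at ht' ⊢
        rw [add_mul (l₂.length + 1), one_mul]
        omega
    refine ⟨Prog.loop Prog.head q, (L + 1) * (R + Q.comp R + 2), fun e => ?_⟩
    obtain ⟨t, ht, ht'⟩ := key e (l e) [] rfl
    refine ⟨t, ht, ht'.trans ?_⟩
    have h1 : esize e ≤ (Data.cons (Enc.enc (l e))
        (Data.cons (Enc.enc e) (Enc.enc (i e)))).size := by
      simp only [Data.size, esize]
      omega
    simp only [Polynomial.eval_mul, Polynomial.eval_add, Polynomial.eval_comp,
      Polynomial.eval_one, Polynomial.eval_ofNat]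
    have h2 := (length_le_esize (l e)).trans ((hL e).trans (polynomial_eval_mono L h1))
    have h3 := polynomial_eval_mono R h1
    have h4 := polynomial_eval_mono Q h3
    gcongr
  refine Comp.trans (Comp.cons hl (Comp.cons Comp.id hi)) (Comp.tail (Comp.tail hloop))

end Fold

/-! ### Polynomial-time operations on lists -/

section Lists

variable {ε α β γ : Type} [Enc ε] [Enc α] [Enc β] [Enc γ]

namespace PT

@[fun_prop] theorem reverse {f : ε → List α} (hf : PT f) : PT fun e => (f e).reverse := by
  have h : ∀ (l acc : List α), l.foldl (fun b a => a :: b) acc = l.reverse ++ acc := by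
    intro l
    induction l with
    | nil => simp
    | cons a l ih => intro acc; simp [ih]
  have hs : ∀ l : List α, esize l.reverse = esize l := by
    intro l
    induction l with
    | nil => rfl
    | cons a l ih =>
      have := esize_append l.reverse [a]
      simp at this ⊢
      omega
  have := PT.foldl (f := fun (_ : ε) (b : List α) (a : α) => a :: b) hf (PT.const ([] : List α))
    (by fun_prop) hf.polyBdd (fun e l₁ l₂ hl => by
      have := esize_append l₁ l₂
      have := one_le_esize l₂
      rw [h, List.append_nil, hs, hl]
      omega)
  simpa [h] using this

@[fun_prop] theorem append {f g : ε → List α} (hf : PT f) (hg : PT g) :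
    PT fun e => f e ++ g e := by
  have h : ∀ (l acc : List α), l.foldl (fun b a => a :: b) acc = l.reverse ++ acc := by
    intro l
    induction l with
    | nil => simp
    | cons a l ih => intro acc; simp [ih]
  have := PT.foldl (f := fun (_ : ε) (b : List α) (a : α) => a :: b) hf.reverse hg
    (by fun_prop) (hf.reverse.polyBdd.add hg.polyBdd) (fun e l₁ l₂ hl => by
      have h1 := esize_append l₁ l₂
      have h2 := one_le_esize l₂
      have h3 := h l₁ (g e)
      have h4 : esize (l₁.foldl (fun b a => a :: b) (g e)) ≤ esize l₁ + esize (g e) := by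
        clear h1 h2 h3 hl
        generalize g e = acc
        induction l₁ generalizing acc with
        | nil => simp
        | cons a l ih =>
          have := ih (a :: acc)
          simp at this ⊢
          omega
      rw [← hl] at h1
      omega)
  simpa [h] using this

omit [Enc α] in
theorem esize_flatMap_le {f : α → List β} {N : ℕ} (l : List α) (h : ∀ a ∈ l, esize (f a) ≤ N) :
    esize (l.flatMap f) ≤ l.length * N + 1 := by
  induction l with
  | nil => simp
  | cons a l ih =>
    have h1 := ih fun b hb => h b (List.mem_cons_of_mem _ hb)
    have h2 := h a List.mem_cons_self
    have h3 := esize_append (f a) (l.flatMap f)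
    simp only [List.flatMap_cons, List.length_cons, add_mul]
    omega

@[fun_prop] theorem flatMap {l : ε → List α} {f : ε → α → List β} (hl : PT l)
    (hf : PT fun p : ε × α => f p.1 p.2) : PT fun e => (l e).flatMap (f e) := by
  have h : ∀ e (l : List α) acc,
      l.foldl (fun b a => b ++ f e a) acc = acc ++ l.flatMap (f e) := by
    intro e l
    induction l with
    | nil => simp
    | cons a l ih => intro acc; simp [ih]
  obtain ⟨P, hP⟩ := hf.polyBdd
  have := PT.foldl (f := fun (e : ε) (b : List β) (a : α) => b ++ f e a) hl
    (PT.const ([] : List β))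
    ((PT.fst (PT.snd PT.id)).append (hf.comp ((PT.fst PT.id).prodMk (PT.snd (PT.snd PT.id)))))
    ((hl.polyBdd.mul (((PolyBdd.self.add hl.polyBdd).add (PolyBdd.const 1)).eval P)).add
      (PolyBdd.const 1)) (fun e l₁ l₂ hl' => by
      rw [h, List.nil_append]
      refine (esize_flatMap_le (N := P.eval (esize e + esize (l e) + 1)) _ fun a ha => ?_).trans ?_
      · refine (hP (e, a)).trans (polynomial_eval_mono _ ?_)
        have := esize_le_of_mem (show a ∈ l e by simp [hl', ha])
        simp
        omega
      · have h1 : l₁.length ≤ esize (l e) := by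
          refine le_trans ?_ (length_le_esize _)
          simp [hl']
        gcongr)
  simpa [h] using this

@[fun_prop] theorem map {l : ε → List α} {f : ε → α → β} (hl : PT l)
    (hf : PT fun p : ε × α => f p.1 p.2) : PT fun e => (l e).map (f e) := by
  have : PT fun e => (l e).flatMap fun a => [f e a] := by fun_prop
  simpa only [← List.map_eq_flatMap] using this

@[fun_prop] theorem filter {l : ε → List α} {f : ε → α → Bool} (hl : PT l)
    (hf : PT fun p : ε × α => f p.1 p.2) : PT fun e => (l e).filter (f e) := by
  have h : ∀ e (l : List α), l.filter (f e) = l.flatMap fun a => bif f e a then [a] else [] := by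
    intro e l
    induction l with
    | nil => rfl
    | cons a l ih => cases h : f e a <;> simp [ih, h]
  simp only [h]
  fun_prop

@[fun_prop] theorem isEmpty {l : ε → List α} (hl : PT l) : PT fun e => (l e).isEmpty := by
  have h : ∀ e, (l e).isEmpty = (l e).head?.elim true fun _ => false := by
    intro e
    cases l e <;> rfl
  simp only [h]
  fun_prop

@[fun_prop] theorem isSome {o : ε → Option α} (ho : PT o) : PT fun e => (o e).isSome := by
  have h : ∀ e, (o e).isSome = (o e).elim false fun _ => true := by
    intro e
    cases o e <;> rfl
  simp only [h]
  fun_prop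

@[fun_prop] theorem isNone {o : ε → Option α} (ho : PT o) : PT fun e => (o e).isNone := by
  have h : ∀ e, (o e).isNone = (o e).elim true fun _ => false := by
    intro e
    cases o e <;> rfl
  simp only [h]
  fun_prop

@[fun_prop] theorem toList {o : ε → Option α} (ho : PT o) : PT fun e => (o e).toList := by
  have h : ∀ e, (o e).toList = (o e).elim [] fun a => [a] := by
    intro e
    cases o e <;> rfl
  simp only [h]
  fun_prop

@[fun_prop] theorem getD {o : ε → Option α} {g : ε → α} (ho : PT o) (hg : PT g) :
    PT fun e => (o e).getD (g e) := by
  have h : ∀ e, (o e).getD (g e) = (o e).elim (g e) fun a => a := by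
    intro e
    cases o e <;> rfl
  simp only [h]
  fun_prop

@[fun_prop] theorem option_bind {o : ε → Option α} {f : ε → α → Option β} (ho : PT o)
    (hf : PT fun p : ε × α => f p.1 p.2) : PT fun e => (o e).bind (f e) := by
  have h : ∀ e, (o e).bind (f e) = (o e).elim none (f e) := by
    intro e
    cases o e <;> rfl
  simp only [h]
  fun_prop

@[fun_prop] theorem option_map {o : ε → Option α} {f : ε → α → β} (ho : PT o)
    (hf : PT fun p : ε × α => f p.1 p.2) : PT fun e => (o e).map (f e) := by
  have h : ∀ e, (o e).map (f e) = (o e).elim none fun a => some (f e a) := by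
    intro e
    cases o e <;> rfl
  simp only [h]
  fun_prop

@[fun_prop] theorem bool_and {f g : ε → Bool} (hf : PT f) (hg : PT g) :
    PT fun e => f e && g e := by
  have h : ∀ e, (f e && g e) = bif f e then g e else false := by
    intro e
    cases f e <;> rfl
  simp only [h]
  fun_prop

@[fun_prop] theorem bool_or {f g : ε → Bool} (hf : PT f) (hg : PT g) :
    PT fun e => f e || g e := by
  have h : ∀ e, (f e || g e) = bif f e then true else g e := by
    intro e
    cases f e <;> rfl
  simp only [h]
  fun_prop

@[fun_prop] theorem bool_not {f : ε → Bool} (hf : PT f) : PT fun e => !(f e) := by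
  have h : ∀ e, (!(f e)) = bif f e then false else true := by
    intro e
    cases f e <;> rfl
  simp only [h]
  fun_prop

@[fun_prop] theorem any {l : ε → List α} {f : ε → α → Bool} (hl : PT l)
    (hf : PT fun p : ε × α => f p.1 p.2) : PT fun e => (l e).any (f e) := by
  have h : ∀ e, (l e).any (f e) = !((l e).filter (f e)).isEmpty := by
    intro e
    rw [Bool.eq_iff_iff]
    simp
  simp only [h]
  fun_prop

@[fun_prop] theorem all {l : ε → List α} {f : ε → α → Bool} (hl : PT l)
    (hf : PT fun p : ε × α => f p.1 p.2) : PT fun e => (l e).all (f e) := by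
  have h : ∀ e, (l e).all (f e) = !((l e).any fun a => !(f e a)) := by
    intro e
    rw [Bool.eq_iff_iff]
    simp
  simp only [h]
  fun_prop

@[fun_prop] theorem find? {l : ε → List α} {f : ε → α → Bool} (hl : PT l)
    (hf : PT fun p : ε × α => f p.1 p.2) : PT fun e => (l e).find? (f e) := by
  have h : ∀ e, (l e).find? (f e) = ((l e).filter (f e)).head? := by
    intro e
    rw [List.head?_filter]
  simp only [h]
  fun_prop

/-! Natural numbers in unary -/

@[fun_prop] theorem replicate_unit {f : ε → ℕ} (hf : PT f) :
    PT fun e => List.replicate (f e) () := by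
  refine hf.congr (fun _ => rfl) fun e => ?_
  dsimp only
  generalize f e = n
  induction n with
  | zero => rfl
  | succ n ih => simp [List.replicate_succ, ih]

@[fun_prop] theorem length {f : ε → List α} (hf : PT f) : PT fun e => (f e).length := by
  have h : PT fun e => (f e).map fun _ => () := by fun_prop
  refine Comp.congr h (fun _ => rfl) fun e => ?_
  dsimp only
  generalize f e = l
  induction l with
  | nil => rfl
  | cons a l ih => rw [List.map_cons, enc_cons, ih]; rfl

@[fun_prop] theorem nat_add {f g : ε → ℕ} (hf : PT f) (hg : PT g) : PT fun e => f e + g e := by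
  have h : ∀ e, f e + g e = (List.replicate (f e) () ++ List.replicate (g e) ()).length := by
    simp
  simp only [h]
  fun_prop

@[fun_prop] theorem range {f : ε → ℕ} (hf : PT f) : PT fun e => List.range (f e) := by
  have h : ∀ n, (List.replicate n ()).foldl (fun (b : List ℕ) _ => b ++ [b.length]) [] =
      List.range n := by
    intro n
    induction n with
    | zero => rfl
    | succ n ih => rw [List.replicate_succ', List.foldl_append, ih]; simp [List.range_succ]
  have := PT.foldl (f := fun (_ : ε) (b : List ℕ) (_ : Unit) => b ++ [b.length])
    hf.replicate_unit (PT.const ([] : List ℕ)) (by fun_prop)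
    ((hf.polyBdd_nat.mul ((hf.polyBdd_nat.add hf.polyBdd_nat).add (PolyBdd.const 2))).add
      (PolyBdd.const 1))
    (fun e l₁ l₂ hl => by
      rw [show l₁ = List.replicate l₁.length () from List.eq_replicate_of_mem (by simp), h]
      have h1 : l₁.length ≤ f e := by
        have := congrArg List.length hl
        simp at this
        omega
      refine (esize_le_of_forall (N := 2 * f e + 1) fun a ha => ?_).trans ?_
      · rw [List.mem_range] at ha
        simp
        omega
      · rw [List.length_range]
        have : 2 * f e + 1 + 1 = f e + f e + 2 := by ring
        rw [this]
        gcongr)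
  simpa [h] using this

@[fun_prop] theorem nat_pred {f : ε → ℕ} (hf : PT f) : PT fun e => f e - 1 :=
  (Comp.tail hf).congr (fun _ => rfl) fun e => by dsimp only; cases f e <;> rfl

@[fun_prop] theorem nat_sub {f g : ε → ℕ} (hf : PT f) (hg : PT g) : PT fun e => f e - g e := by
  have h : ∀ (l : List Unit) n, l.foldl (fun (b : ℕ) _ => b - 1) n = n - l.length := by
    intro l
    induction l with
    | nil => simp
    | cons a l ih => intro n; rw [List.foldl_cons, ih, List.length_cons]; omega
  have := PT.foldl (f := fun (_ : ε) (b : ℕ) (_ : Unit) => b - 1)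
    hg.replicate_unit hf (by fun_prop) hf.polyBdd
    (fun e l₁ l₂ hl => by rw [h]; simp)
  simpa [h] using this

@[fun_prop] theorem drop {f : ε → ℕ} {l : ε → List α} (hf : PT f) (hl : PT l) :
    PT fun e => (l e).drop (f e) := by
  have h : ∀ n (l : List α), (List.replicate n ()).foldl (fun (b : List α) _ => b.tail) l =
      l.drop n := by
    intro n
    induction n with
    | zero => simp
    | succ n ih => intro l; rw [List.replicate_succ, List.foldl_cons, ih]; simp
  have hs : ∀ n (l : List α), esize (l.drop n) ≤ esize l := by
    intro n l
    have := esize_append (l.take n) (l.drop n)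
    rw [List.take_append_drop] at this
    have := one_le_esize (l.take n)
    omega
  have := PT.foldl (f := fun (_ : ε) (b : List α) (_ : Unit) => b.tail)
    hf.replicate_unit hl (by fun_prop) hl.polyBdd
    (fun e l₁ l₂ _ => by
      rw [show l₁ = List.replicate l₁.length () from List.eq_replicate_of_mem (by simp), h]
      exact hs _ _)
  simpa [h] using this

@[fun_prop] theorem getElem? {f : ε → ℕ} {l : ε → List α} (hf : PT f) (hl : PT l) :
    PT fun e => (l e)[f e]? := by
  have h : ∀ e, (l e)[f e]? = ((l e).drop (f e)).head? := by
    intro e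
    rw [List.head?_drop]
  simp only [h]
  fun_prop

end PT

/-! ### Equality tests, membership and counting. -/

/-- Types on which equality can be tested in polynomial time. -/
class PTEq (α : Type) [Enc α] [DecidableEq α] : Prop where
  pt : PT fun p : α × α => decide (p.1 = p.2)

@[fun_prop] theorem PT.decide_eq [DecidableEq α] [PTEq α] {f g : ε → α} (hf : PT f) (hg : PT g) :
    PT fun e => decide (f e = g e) := PT.comp PTEq.pt (hf.prodMk hg)

@[fun_prop] theorem PT.beq [DecidableEq α] [PTEq α] [BEq α] [LawfulBEq α] {f g : ε → α}
    (hf : PT f) (hg : PT g) : PT fun e => f e == g e := by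
  simp only [beq_eq_decide]
  fun_prop

instance : PTEq ℕ where
  pt := by
    have h : ∀ p : ℕ × ℕ, decide (p.1 = p.2) = ((List.replicate (p.1 - p.2) ()).isEmpty &&
        (List.replicate (p.2 - p.1) ()).isEmpty) := by
      intro p
      rw [Bool.eq_iff_iff]
      simp [Nat.sub_eq_zero_iff_le]
      omega
    simp only [h]
    fun_prop

instance [DecidableEq α] [DecidableEq β] [PTEq α] [PTEq β] : PTEq (α × β) where
  pt := by
    have h : ∀ p : (α × β) × (α × β), decide (p.1 = p.2) =
        (decide (p.1.1 = p.2.1) && decide (p.1.2 = p.2.2)) := by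
      intro p
      rw [Bool.eq_iff_iff]
      simp [Prod.ext_iff]
    simp only [h]
    fun_prop

instance [DecidableEq α] [PTEq α] : PTEq (List α) where
  pt := by
    -- The state is a verdict and the unread part of the second list. Once that list runs out the
    -- verdict is `false`; a nonempty rest at the end is tested separately.
    let step : Bool × List α → α → Bool × List α :=
      fun s a => (s.2.head?.elim false fun b => s.1 && decide (a = b), s.2.tail)
    have h : ∀ (l l' : List α) (b : Bool), (b && decide (l = l')) =
        ((l.foldl step (b, l')).1 && (l.foldl step (b, l')).2.isEmpty) := by
      intro l
      induction l with
      | nil => intro l' b; cases l' <;> simp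
      | cons a l ih =>
        intro l' b
        rw [List.foldl_cons, ← ih]
        cases l' with
        | nil => simp
        | cons c l' =>
          rw [Bool.eq_iff_iff]
          simp only [List.cons.injEq, Bool.and_eq_true, decide_eq_true_iff, List.head?_cons,
            Option.elim_some, List.tail_cons, and_assoc]
          exact and_congr_right' (and_congr_right' decide_eq_true_iff.symm)
    have hs : ∀ (l l' : List α) b, esize (l.foldl step (b, l')).2 ≤ esize l' := by
      intro l
      induction l with
      | nil => simp
      | cons a l ih =>
        intro l' b
        refine (ih _ _).trans ?_
        cases l' <;> simp; omega
    have hpt := PT.foldl (l := fun p : List α × List α => p.1) (i := fun p => (true, p.2))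
      (f := fun _ => step) (by fun_prop) (by fun_prop) (by fun_prop)
      (PolyBdd.self.add (PolyBdd.const 4)) (fun p l₁ _ _ => by
        have := hs l₁ p.2 true
        have := esize_bool (l₁.foldl step (true, p.2)).1
        simp only [esize_pair] at *
        omega)
    have h' : ∀ p : List α × List α, decide (p.1 = p.2) =
        ((p.1.foldl step (true, p.2)).1 && (p.1.foldl step (true, p.2)).2.isEmpty) := by
      intro p
      rw [← h, Bool.true_and]
    simp only [h']
    fun_prop

@[fun_prop] theorem PT.contains [DecidableEq α] [PTEq α] [BEq α] [LawfulBEq α]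
    {l : ε → List α} {f : ε → α} (hl : PT l)
    (hf : PT f) : PT fun e => (l e).contains (f e) := by
  simp only [List.contains_eq_any_beq]
  fun_prop

@[fun_prop] theorem PT.count [DecidableEq α] [PTEq α] [BEq α] [LawfulBEq α]
    {l : ε → List α} {f : ε → α} (hl : PT l)
    (hf : PT f) : PT fun e => (l e).count (f e) := by
  have h : ∀ e, (l e).count (f e) = ((l e).filter fun a => a == f e).length := by
    intro e
    rw [List.count, List.countP_eq_length_filter]
  simp only [h]
  fun_prop

end Lists

/-! ### Binary arithmetic -/

section Binary

theorem esize_bits_le (l : List Bool) : esize l ≤ 4 * l.length + 1 := by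
  have := esize_le_of_forall (l := l) (N := 3) fun b _ => esize_bool b
  omega

/-- The number with a given list of binary digits, least significant digit first. -/
def bval : List Bool → ℕ
  | [] => 0
  | b :: l => b.toNat + 2 * bval l

theorem bval_bits (m : ℕ) : bval m.bits = m := by
  induction m using Nat.binaryRec' with
  | zero => simp [bval]
  | bit b n h ih =>
    rw [Nat.bits_append_bit _ _ h, bval, ih, Nat.bit_val]
    ring

/-- Add a carry. -/
def binc : Bool → List Bool → List Bool
  | c, [] => bif c then [true] else []
  | c, x :: l => (c ^^ x) :: binc (c && x) l

theorem bval_binc (c : Bool) (l : List Bool) : bval (binc c l) = c.toNat + bval l := by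
  induction l generalizing c with
  | nil => cases c <;> simp [binc, bval]
  | cons x l ih => cases c <;> cases x <;> simp [binc, bval, ih]; ring

theorem length_binc_le (c : Bool) (l : List Bool) : (binc c l).length ≤ l.length + 1 := by
  induction l generalizing c with
  | nil => cases c <;> simp [binc]
  | cons x l ih => simpa [binc] using ih _

/-- Binary addition with a carry. -/
def badd : List Bool → List Bool → Bool → List Bool
  | [], l, c => binc c l
  | x :: a, l, c =>
    ((x ^^ l.head?.getD false) ^^ c) ::
      badd a l.tail (bif x ^^ l.head?.getD false then c else x)

/-- The new carry is the majority of two digits and the old carry: the old carry if the digits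
differ, their common value otherwise. Missing digits of `l` are read as zeros. -/
theorem bval_badd (a l : List Bool) (c : Bool) :
    bval (badd a l c) = bval a + bval l + c.toNat := by
  induction a generalizing l c with
  | nil => simp [badd, bval, bval_binc]; ring
  | cons x a ih =>
    rcases l with - | ⟨y, l⟩
    · cases x <;> cases c <;> simp [badd, bval, ih] <;> ring
    · cases x <;> cases y <;> cases c <;> simp [badd, bval, ih] <;> ring

theorem length_badd_le (a l : List Bool) (c : Bool) :
    (badd a l c).length ≤ max a.length l.length + 1 := by
  induction a generalizing l c with
  | nil => simpa [badd] using length_binc_le c l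
  | cons x a ih =>
    have := ih l.tail (bif x ^^ l.head?.getD false then c else x)
    simp [badd] at this ⊢
    omega

/-- Binary multiplication. -/
def bmul : List Bool → List Bool → List Bool
  | [], _ => []
  | x :: a, l => badd (bif x then l else []) (false :: bmul a l) false

theorem bval_bmul (a l : List Bool) : bval (bmul a l) = bval a * bval l := by
  induction a with
  | nil => simp [bmul, bval]
  | cons x a ih => cases x <;> simp [bmul, bval, bval_badd, ih] <;> ring

/-- Each digit of `a` costs at most a shift and a carry. Growth is additive, so the partial products
stay small enough for `PT.foldl`. -/
theorem length_bmul_le (a l : List Bool) : (bmul a l).length ≤ 2 * a.length + l.length := by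
  induction a with
  | nil => simp [bmul]
  | cons x a ih =>
    have := length_badd_le (bif x then l else []) (false :: bmul a l) false
    have h : (bif x then l else []).length ≤ l.length := by cases x <;> simp
    simp only [bmul, List.length_cons] at *
    omega

/-- Comparison of binary numbers, with the result `f` in case of equality. -/
def ble : List Bool → List Bool → Bool → Bool
  | [], l, f => l.any (fun b => b) || f
  | x :: a, l, f => ble a l.tail (bif x ^^ l.head?.getD false then !x else f)

theorem any_iff_bval_pos (l : List Bool) : l.any (fun b => b) = true ↔ 0 < bval l := by
  induction l with
  | nil => simp [bval]
  | cons x l ih => cases x <;> simp_all [bval]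

/-- The flag is the verdict of the lower digits. Equal digits keep it, while differing digits
override it, being more significant. -/
theorem ble_iff (a l : List Bool) (f : Bool) :
    ble a l f = true ↔ bval a < bval l ∨ (bval a = bval l ∧ f = true) := by
  induction a generalizing l f with
  | nil =>
    have := any_iff_bval_pos l
    simp only [ble, Bool.or_eq_true, this, bval]
    rcases Nat.eq_zero_or_pos (bval l) with h | h
    · simp [h]
    · simp [h, h.ne]
  | cons x a ih =>
    rw [ble, ih]
    rcases l with - | ⟨y, l⟩
    · cases x <;> simp [bval]
    · cases x <;> cases y <;> simp [bval] <;> omega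

/-- A number in unary, converted to binary. -/
def bofNat (n : ℕ) : List Bool := (List.replicate n ()).foldl (fun l _ => binc true l) []

theorem bofNat_succ (n : ℕ) : bofNat (n + 1) = binc true (bofNat n) := by
  rw [bofNat, List.replicate_succ', List.foldl_append]
  rfl

theorem bval_bofNat (n : ℕ) : bval (bofNat n) = n := by
  induction n with
  | zero => rfl
  | succ n ih => rw [bofNat_succ, bval_binc, ih, Bool.toNat_true, add_comm]

theorem length_bofNat_le (n : ℕ) : (bofNat n).length ≤ n := by
  induction n with
  | zero => simp [bofNat]
  | succ n ih =>
    rw [bofNat_succ]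
    exact (length_binc_le _ _).trans (by omega)

end Binary

/-! ### Running time of binary arithmetic. -/

section BinaryPT

variable {ε : Type} [Enc ε]

namespace PT

@[fun_prop] theorem xor {f g : ε → Bool} (hf : PT f) (hg : PT g) : PT fun e => f e ^^ g e := by
  have h : ∀ e, (f e ^^ g e) = bif f e then !(g e) else g e := by
    intro e
    cases f e <;> simp
  simp only [h]
  fun_prop

@[fun_prop] theorem binc {f : ε → Bool} {g : ε → List Bool} (hf : PT f) (hg : PT g) :
    PT fun e => binc (f e) (g e) := by
  -- The state is the carry and the digits produced so far in reverse order.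
  let step : Bool × List Bool → Bool → Bool × List Bool := fun s x => (s.1 && x, (s.1 ^^ x) :: s.2)
  have h : ∀ (l : List Bool) c out, (l.foldl step (c, out)).2.reverse ++
      (bif (l.foldl step (c, out)).1 then [true] else []) = out.reverse ++ CapSteiner.binc c l := by
    intro l
    induction l with
    | nil => intro c out; simp [CapSteiner.binc]
    | cons x l ih =>
      intro c out
      rw [List.foldl_cons, ih, CapSteiner.binc]
      simp
  have hs : ∀ (l : List Bool) s, (l.foldl step s).2.length = l.length + s.2.length := by
    intro l
    induction l with
    | nil => simp
    | cons x l ih => intro s; rw [List.foldl_cons, ih]; simp [step]; omega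
  have hpt := PT.foldl (f := fun _ => step) hg (hf.prodMk (PT.const [])) (by fun_prop)
    (B := fun e => 4 * (g e).length + 5)
    (((PolyBdd.const 4).mul hg.polyBdd_length).add (PolyBdd.const 5))
    (fun e l₁ l₂ hl => by
      have h1 := hs l₁ (f e, [])
      have h2 := esize_bool (l₁.foldl step (f e, [])).1
      have h3 := esize_bits_le (l₁.foldl step (f e, [])).2
      have h4 := congrArg List.length hl
      simp only [esize_pair, List.length_append, List.length_nil] at *
      omega)
  have h' : ∀ e, CapSteiner.binc (f e) (g e) = ((g e).foldl step (f e, [])).2.reverse ++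
      (bif ((g e).foldl step (f e, [])).1 then [true] else []) := by
    intro e
    rw [h]
    rfl
  simp only [h']
  fun_prop

@[fun_prop] theorem badd {f g : ε → List Bool} {k : ε → Bool} (hf : PT f) (hg : PT g)
    (hk : PT k) : PT fun e => badd (f e) (g e) (k e) := by
  let step : (List Bool × Bool) × List Bool → Bool → (List Bool × Bool) × List Bool := fun s x =>
    ((s.1.1.tail, bif x ^^ s.1.1.head?.getD false then s.1.2 else x),
      ((x ^^ s.1.1.head?.getD false) ^^ s.1.2) :: s.2)
  have h : ∀ (a l : List Bool) c out, (a.foldl step ((l, c), out)).2.reverse ++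
      CapSteiner.binc (a.foldl step ((l, c), out)).1.2 (a.foldl step ((l, c), out)).1.1 =
      out.reverse ++ CapSteiner.badd a l c := by
    intro a
    induction a with
    | nil => intro l c out; simp [CapSteiner.badd]
    | cons x a ih =>
      intro l c out
      rw [List.foldl_cons, ih, CapSteiner.badd]
      simp
  have hs : ∀ (l : List Bool) s, (l.foldl step s).2.length = l.length + s.2.length ∧
      (l.foldl step s).1.1.length ≤ s.1.1.length := by
    intro l
    induction l with
    | nil => simp
    | cons x l ih =>
      intro s
      rw [List.foldl_cons]
      have := ih (step s x)
      simp [step] at this ⊢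
      omega
  have hpt := PT.foldl (f := fun _ => step) hf ((hg.prodMk hk).prodMk (PT.const []))
    (by fun_prop) (B := fun e => 4 * ((f e).length + (g e).length) + 20)
    (((PolyBdd.const 4).mul (hf.polyBdd_length.add hg.polyBdd_length)).add (PolyBdd.const 20))
    (fun e l₁ l₂ hl => by
      have h1 := hs l₁ ((g e, k e), [])
      have h2 := esize_bool (l₁.foldl step ((g e, k e), [])).1.2
      have h3 := esize_bits_le (l₁.foldl step ((g e, k e), [])).2
      have h5 := esize_bits_le (l₁.foldl step ((g e, k e), [])).1.1
      have h4 := congrArg List.length hl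
      simp only [esize_pair, List.length_append, List.length_nil] at *
      omega)
  have h' : ∀ e, CapSteiner.badd (f e) (g e) (k e) =
      ((f e).foldl step ((g e, k e), [])).2.reverse ++
      CapSteiner.binc ((f e).foldl step ((g e, k e), [])).1.2
        ((f e).foldl step ((g e, k e), [])).1.1 := by
    intro e
    rw [h]
    rfl
  simp only [h']
  fun_prop

@[fun_prop] theorem bmul {f g : ε → List Bool} (hf : PT f) (hg : PT g) :
    PT fun e => bmul (f e) (g e) := by
  -- The recursion starts at the most significant digit, so it is a left fold over the reversed
  -- digits.
  have h : ∀ l a : List Bool, a.reverse.foldl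
      (fun acc x => CapSteiner.badd (bif x then l else []) (false :: acc) false) [] =
      CapSteiner.bmul a l := by
    intro l a
    rw [List.foldl_reverse]
    induction a with
    | nil => rfl
    | cons x a ih => rw [List.foldr_cons, ih, CapSteiner.bmul]
  have hpt := PT.foldl
    (f := fun e acc x => CapSteiner.badd (bif x then g e else []) (false :: acc) false)
    hf.reverse (PT.const []) (by fun_prop)
    (B := fun e => 4 * (2 * (f e).length + (g e).length) + 1)
    (((PolyBdd.const 4).mul (((PolyBdd.const 2).mul hf.polyBdd_length).add
      hg.polyBdd_length)).add (PolyBdd.const 1))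
    (fun e l₁ l₂ hl => by
      have h1 := h (g e) l₁.reverse
      rw [List.reverse_reverse] at h1
      rw [h1]
      have h2 := length_bmul_le l₁.reverse (g e)
      have h3 := esize_bits_le (CapSteiner.bmul l₁.reverse (g e))
      have h4 := congrArg List.length hl
      simp only [List.length_append, List.length_reverse] at *
      omega)
  simpa only [h] using hpt

@[fun_prop] theorem ble {f g : ε → List Bool} {k : ε → Bool} (hf : PT f) (hg : PT g)
    (hk : PT k) : PT fun e => ble (f e) (g e) (k e) := by
  let step : List Bool × Bool → Bool → List Bool × Bool := fun s x =>
    (s.1.tail, bif x ^^ s.1.head?.getD false then !x else s.2)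
  have h : ∀ (a l : List Bool) c, CapSteiner.ble a l c =
      ((a.foldl step (l, c)).1.any (fun b => b) || (a.foldl step (l, c)).2) := by
    intro a
    induction a with
    | nil => intro l c; simp [CapSteiner.ble]
    | cons x a ih =>
      intro l c
      rw [List.foldl_cons, CapSteiner.ble, ih]
  have hs : ∀ (l : List Bool) s, (l.foldl step s).1.length ≤ s.1.length := by
    intro l
    induction l with
    | nil => simp
    | cons x l ih =>
      intro s
      rw [List.foldl_cons]
      have := ih (step s x)
      simp [step] at this ⊢
      omega
  have hpt := PT.foldl (f := fun _ => step) hf (hg.prodMk hk)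
    (by fun_prop) (B := fun e => 4 * (g e).length + 5)
    (((PolyBdd.const 4).mul hg.polyBdd_length).add (PolyBdd.const 5))
    (fun e l₁ l₂ hl => by
      have h1 := hs l₁ (g e, k e)
      have h2 := esize_bool (l₁.foldl step (g e, k e)).2
      have h3 := esize_bits_le (l₁.foldl step (g e, k e)).1
      simp only [esize_pair] at *
      omega)
  simp only [h]
  fun_prop

@[fun_prop] theorem bofNat {f : ε → ℕ} (hf : PT f) : PT fun e => bofNat (f e) :=
  PT.foldl (f := fun _ l _ => CapSteiner.binc true l) hf.replicate_unit (PT.const [])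
    (by fun_prop) (B := fun e => 4 * f e + 1)
    (((PolyBdd.const 4).mul hf.polyBdd_nat).add (PolyBdd.const 1))
    (fun e l₁ l₂ hl => by
      have h1 := length_bofNat_le l₁.length
      have h2 := esize_bits_le (CapSteiner.bofNat l₁.length)
      have h4 := congrArg List.length hl
      rw [CapSteiner.bofNat, ← show l₁ = List.replicate l₁.length () from
        List.eq_replicate_of_mem (by simp)] at h1 h2
      simp only [List.length_append, List.length_replicate] at *
      omega)

end PT

end BinaryPT

/-! ### The algorithm -/

/-- Matrices of capacities, numerators and denominators, with the root and the terminals. -/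
abbrev RawNetwork : Type :=
  List (List (Option (List Bool × List Bool × List Bool))) × List Bool × List Bool

/-- Partial solutions for lists of tokens. -/
abbrev Table : Type := List (List ℕ × Option (List (ℕ × ℕ)))

section Algorithm

/-- The vertices. -/
def verts (R : RawNetwork) : List ℕ := List.range R.1.length

/-- The data on an arc, if there is one. -/
def entry (R : RawNetwork) (u v : ℕ) : Option (List Bool × List Bool × List Bool) :=
  (R.1[u]?).bind fun row => (row[v]?).bind fun o => o

/-- The root test. -/
def isRoot (R : RawNetwork) (v : ℕ) : Bool := (R.2.1[v]?).getD false

/-- The terminal test. -/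
def isTerm (R : RawNetwork) (v : ℕ) : Bool := (R.2.2[v]?).getD false

/-- The number of terminals. -/
def numTerm (R : RawNetwork) : ℕ := (R.2.2.filter fun b => b).length

/-- The first vertex outside of `L` all of whose predecessors are in `L`. -/
def nextVert (R : RawNetwork) (L : List ℕ) : Option ℕ :=
  (verts R).find? fun v => !(L.contains v) &&
    (verts R).all fun u => (entry R u v).isNone || L.contains u

/-- A topological order. -/
def topo (R : RawNetwork) : List ℕ :=
  (verts R).foldl (fun L _ => (nextVert R L).elim L fun v => L ++ [v]) []

/-- Addition of fractions. -/
def addFrac (p q : List Bool × List Bool) : List Bool × List Bool :=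
  (badd (bmul q.2 p.1) (bmul q.1 p.2) false, bmul q.2 p.2)

/-- The length of an arc. -/
def arcLen (R : RawNetwork) (a : ℕ × ℕ) : List Bool × List Bool :=
  (entry R a.1 a.2).elim ([], [true]) fun c => c.2

/-- The total length of a list of arcs. -/
def cost (R : RawNetwork) (A : List (ℕ × ℕ)) : List Bool × List Bool :=
  A.foldl (fun s a => addFrac s (arcLen R a)) ([], [true])

/-- Comparison of total lengths. -/
def better (R : RawNetwork) (A B : List (ℕ × ℕ)) : Bool :=
  ble (bmul (cost R A).1 (cost R B).2) (bmul (cost R B).1 (cost R A).2) true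

/-- A shortest element of a list of lists of arcs. -/
def best (R : RawNetwork) (l : List (List (ℕ × ℕ))) : Option (List (ℕ × ℕ)) :=
  l.foldl (fun b A => b.elim (some A) fun B => bif better R A B then some A else some B) none

/-- The lists of at most `k` vertices. -/
def states (R : RawNetwork) : ℕ → List (List ℕ)
  | 0 => [[]]
  | k + 1 => [] :: (verts R).flatMap fun v => (states R k).map fun x => v :: x

/-- Table lookup. -/
def lookup (T : Table) (x : List ℕ) : Option (List (ℕ × ℕ)) :=
  (T.find? fun p => p.1 == x).bind fun p => p.2

/-- The partial solutions obtained by moving all tokens at `v` along an arc into `v`. -/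
def move (R : RawNetwork) (T : Table) (x : List ℕ) (v : ℕ) : List (List (ℕ × ℕ)) :=
  (verts R).flatMap fun u => (entry R u v).elim [] fun c =>
    -- Additive form of the capacity condition: at least `K - c` of the tokens are not at `v`.
    bif ble (bofNat (numTerm R + x.count v)) (badd (bofNat x.length) c.1 false) true then
      (lookup T (x.map fun y => bif y == v then u else y)).elim [] fun A => [(u, v) :: A]
    else []

/-- One step of the dynamic programming algorithm. -/
def tableStep (R : RawNetwork) (k : ℕ) (T : Table) (v : ℕ) : Table :=
  (states R k).map fun x =>
    (x, bif isRoot R v || !(x.contains v) then lookup T x else best R (move R T x v))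

/-- The initial table. -/
def tableInit (R : RawNetwork) (k : ℕ) : Table :=
  (states R k).map fun x => (x, bif x.all fun v => isRoot R v then some [] else none)

/-- The table after treating the vertices in a list. -/
def table (R : RawNetwork) (k : ℕ) (o : List ℕ) : Table := o.foldl (tableStep R k) (tableInit R k)

/-- The test for sets of terminals that certify feasibility. -/
def isSeed (R : RawNetwork) (κ : ℕ) (x : List ℕ) : Bool :=
  (x.all fun v => x.count v == 1 && isTerm R v) &&
    -- A vanishing truncated difference tests `≤`.
    (κ - x.length == 0 || numTerm R - x.length == 0)

/-- A shortest tree for a certifying set of terminals. -/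
def seedTree (κ : ℕ) (R : RawNetwork) : Option (List (ℕ × ℕ)) :=
  best R (((states R (2 * κ)).filter fun x => isSeed R κ x).flatMap fun x =>
    (lookup (table R (2 * κ) (topo R)) x).toList)

/-- The union of a tree with the arcs of another one that enter none of its vertices. -/
def mergeTrees (R : RawNetwork) (A : List (ℕ × ℕ)) (N : List (List Bool)) : List (List Bool) :=
  (verts R).map fun u => (verts R).map fun v => A.contains (u, v) ||
    ((((N[u]?).bind fun row => row[v]?).getD false) && !(A.any fun a => a.2 == v))

end Algorithm

/-! ### Selection of a shortest candidate, and sizes of tables. -/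

section AlgorithmLemmas

theorem best_eq_none_iff {R : RawNetwork} {l : List (List (ℕ × ℕ))} :
    best R l = none ↔ l = [] := by
  induction l using List.reverseRecOn with
  | nil => simp [best]
  | append_singleton l A ih =>
    rw [best, List.foldl_append]
    change (Option.elim (best R l) _ _) = none ↔ _
    cases best R l with
    | none => simp
    | some B => cases h : better R A B <;> simp [h]

theorem best_mem {R : RawNetwork} {l : List (List (ℕ × ℕ))} {A : List (ℕ × ℕ)}
    (h : best R l = some A) : A ∈ l := by
  induction l using List.reverseRecOn generalizing A with
  | nil => simp [best] at h
  | append_singleton l B ih =>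
    rw [best, List.foldl_append] at h
    change (Option.elim (best R l) _ _) = some A at h
    cases hb : best R l with
    | none => simp_all
    | some C =>
      rw [hb] at h
      cases h' : better R B C with
      | true => simp [h'] at h; simp [h]
      | false => simp [h'] at h; subst h; simp [ih hb]

theorem lookup_mem {T : Table} {x : List ℕ} {A : List (ℕ × ℕ)} (h : lookup T x = some A) :
    (x, some A) ∈ T := by
  rw [lookup, Option.bind_eq_some_iff] at h
  obtain ⟨⟨y, B⟩, h1, h2⟩ := h
  have h3 := List.find?_some h1
  have h4 := List.mem_of_find?_eq_some h1
  simp_all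

theorem mem_move_iff {R : RawNetwork} {T : Table} {x : List ℕ} {v : ℕ} {B : List (ℕ × ℕ)} :
    B ∈ move R T x v ↔ ∃ u < R.1.length, ∃ c, entry R u v = some c ∧
      numTerm R + x.count v ≤ x.length + bval c.1 ∧ ∃ A,
      lookup T (x.map fun y => bif y == v then u else y) = some A ∧ B = (u, v) :: A := by
  rw [move, List.mem_flatMap]
  simp only [verts, List.mem_range]
  refine exists_congr fun u => and_congr_right fun _ => ?_
  cases entry R u v with
  | none => simp
  | some c =>
    have := ble_iff (bofNat (numTerm R + x.count v)) (badd (bofNat x.length) c.1 false) true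
    rw [bval_badd, bval_bofNat, bval_bofNat] at this
    simp only [Bool.toNat_false, add_zero, and_true, ← le_iff_lt_or_eq] at this
    cases hb : ble (bofNat (numTerm R + x.count v)) (badd (bofNat x.length) c.1 false) true with
    | false =>
      rw [hb] at this
      simp only [Option.elim_some, hb, cond_false, List.not_mem_nil, Option.some.injEq, false_iff]
      rintro ⟨c', rfl, h, -⟩
      simp [h] at this
    | true =>
      rw [hb] at this
      simp only [Option.elim_some, hb, cond_true, Option.some.injEq, exists_eq_left',
        this.1 rfl, true_and]
      cases lookup T (x.map fun y => bif y == v then u else y) <;> simp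

/-- Treating a vertex adds at most one arc to a partial solution, so entries grow linearly in the
number of treated vertices. -/
theorem esize_table_le {R : RawNetwork} {k N : ℕ} (o : List ℕ) (ho : ∀ v ∈ o, esize v ≤ N)
    {x : List ℕ} {A : List (ℕ × ℕ)} (h : (x, some A) ∈ table R k o) :
    esize A ≤ 1 + o.length * (2 * R.1.length + N + 3) := by
  induction o using List.reverseRecOn generalizing x A with
  | nil =>
    simp only [table, List.foldl_nil, tableInit, List.mem_map, Prod.mk.injEq] at h
    obtain ⟨x', -, rfl, h⟩ := h
    cases hx : x'.all fun v => isRoot R v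
    · simp [hx] at h
    · simp only [hx, cond_true, Option.some.injEq] at h
      subst h
      simp
  | append_singleton o v ih =>
    have ih' := fun x A => @ih (fun v hv => ho v (by simp [hv])) x A
    have hv := ho v (by simp)
    rw [table, List.foldl_append] at h
    change (x, some A) ∈ tableStep R k (table R k o) v at h
    simp only [tableStep, List.mem_map, Prod.mk.injEq] at h
    obtain ⟨x', -, rfl, h⟩ := h
    rw [List.length_append, List.length_singleton, add_mul, one_mul]
    cases hx : isRoot R v || !(x'.contains v)
    · rw [hx, cond_false] at h
      obtain ⟨u, hu, c, -, -, B, hB, rfl⟩ := mem_move_iff.1 (best_mem h)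
      have := ih' _ _ (lookup_mem hB)
      simp at this hv ⊢
      omega
    · rw [hx, cond_true] at h
      have := ih' _ _ (lookup_mem h)
      omega

theorem mem_fst_table {R : RawNetwork} {k : ℕ} {o : List ℕ} {p : List ℕ × Option (List (ℕ × ℕ))}
    (h : p ∈ table R k o) : p.1 ∈ states R k := by
  induction o using List.reverseRecOn with
  | nil =>
    simp only [table, List.foldl_nil, tableInit, List.mem_map] at h
    obtain ⟨x, hx, rfl⟩ := h
    exact hx
  | append_singleton o v ih =>
    rw [table, List.foldl_append] at h
    change p ∈ tableStep R k (table R k o) v at h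
    simp only [tableStep, List.mem_map] at h
    obtain ⟨x, hx, rfl⟩ := h
    exact hx

theorem length_table (R : RawNetwork) (k : ℕ) (o : List ℕ) :
    (table R k o).length = (states R k).length := by
  induction o using List.reverseRecOn with
  | nil => simp [table, tableInit]
  | append_singleton o v ih => rw [table, List.foldl_append]; simp [tableStep]

end AlgorithmLemmas

/-! ### Running time of the algorithm. -/

section AlgorithmPT

variable {ε : Type} [Enc ε]

namespace PT

@[fun_prop] theorem verts {R : ε → RawNetwork} (hR : PT R) : PT fun e => verts (R e) := by
  unfold CapSteiner.verts
  fun_prop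

@[fun_prop] theorem entry {R : ε → RawNetwork} {u v : ε → ℕ} (hR : PT R) (hu : PT u)
    (hv : PT v) : PT fun e => entry (R e) (u e) (v e) := by
  unfold CapSteiner.entry
  fun_prop

@[fun_prop] theorem isRoot {R : ε → RawNetwork} {v : ε → ℕ} (hR : PT R) (hv : PT v) :
    PT fun e => isRoot (R e) (v e) := by
  unfold CapSteiner.isRoot
  fun_prop

@[fun_prop] theorem isTerm {R : ε → RawNetwork} {v : ε → ℕ} (hR : PT R) (hv : PT v) :
    PT fun e => isTerm (R e) (v e) := by
  unfold CapSteiner.isTerm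
  fun_prop

@[fun_prop] theorem numTerm {R : ε → RawNetwork} (hR : PT R) : PT fun e => numTerm (R e) := by
  unfold CapSteiner.numTerm
  fun_prop

@[fun_prop] theorem nextVert {R : ε → RawNetwork} {L : ε → List ℕ} (hR : PT R) (hL : PT L) :
    PT fun e => nextVert (R e) (L e) := by
  unfold CapSteiner.nextVert
  fun_prop

@[fun_prop] theorem topo {R : ε → RawNetwork} (hR : PT R) : PT fun e => topo (R e) := by
  unfold CapSteiner.topo
  refine PT.foldl
    (f := fun e L (_ : ℕ) => (CapSteiner.nextVert (R e) L).elim L fun v => L ++ [v])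
    (by fun_prop) (by fun_prop) (by fun_prop)
    (B := fun e => (CapSteiner.verts (R e)).length * (esize (CapSteiner.verts (R e)) + 1) + 1)
    ((hR.verts.polyBdd_length.mul (hR.verts.polyBdd.add (PolyBdd.const 1))).add
      (PolyBdd.const 1)) fun e l₁ l₂ hl => ?_
  suffices h : ∀ l : List ℕ, (l.foldl (fun L (_ : ℕ) =>
      (CapSteiner.nextVert (R e) L).elim L fun v => L ++ [v]) []).length ≤ l.length ∧
      ∀ v ∈ (l.foldl (fun L (_ : ℕ) =>
      (CapSteiner.nextVert (R e) L).elim L fun v => L ++ [v]) []), v ∈ CapSteiner.verts (R e) by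
    refine (esize_le_of_forall fun v hv => esize_le_of_mem ((h l₁).2 v hv)).trans ?_
    have h1 := (h l₁).1
    have h2 : l₁.length ≤ (CapSteiner.verts (R e)).length := by simp [hl]
    have := Nat.mul_le_mul_right (esize (CapSteiner.verts (R e)) + 1) (h1.trans h2)
    omega
  intro l
  induction l using List.reverseRecOn with
  | nil => simp
  | append_singleton l a ih =>
    rw [List.foldl_append]
    simp only [List.foldl_cons, List.foldl_nil, List.length_append, List.length_singleton]
    generalize l.foldl (fun L (_ : ℕ) =>
      (CapSteiner.nextVert (R e) L).elim L fun v => L ++ [v]) [] = L at ih ⊢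
    cases h : CapSteiner.nextVert (R e) L with
    | none => exact ⟨ih.1.trans (by omega), ih.2⟩
    | some v =>
      refine ⟨by simpa using ih.1, fun w hw => ?_⟩
      rcases List.mem_append.1 hw with hw | hw
      · exact ih.2 w hw
      · rw [List.mem_singleton.1 hw]
        exact List.mem_of_find?_eq_some h

@[fun_prop] theorem addFrac {p q : ε → List Bool × List Bool} (hp : PT p) (hq : PT q) :
    PT fun e => addFrac (p e) (q e) := by
  unfold CapSteiner.addFrac
  fun_prop

@[fun_prop] theorem arcLen {R : ε → RawNetwork} {a : ε → ℕ × ℕ} (hR : PT R) (ha : PT a) :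
    PT fun e => arcLen (R e) (a e) := by
  unfold CapSteiner.arcLen
  fun_prop

theorem esize_arcLen_le (R : RawNetwork) (a : ℕ × ℕ) :
    (CapSteiner.arcLen R a).1.length + (CapSteiner.arcLen R a).2.length ≤ esize R + 1 := by
  cases h : CapSteiner.entry R a.1 a.2 with
  | none => simp [CapSteiner.arcLen, h]
  | some c =>
    rw [CapSteiner.arcLen, h, Option.elim_some]
    simp only [CapSteiner.entry, Option.bind_eq_some_iff] at h
    obtain ⟨row, h1, o, h2, h3⟩ := h
    have h1 := esize_le_of_mem (List.mem_of_getElem? h1)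
    have h2 := esize_le_of_mem (List.mem_of_getElem? h2)
    have h4 := length_le_esize c.2.1
    have h5 := length_le_esize c.2.2
    simp only [h3, esize_some, esize_pair] at *
    omega

@[fun_prop] theorem cost {R : ε → RawNetwork} {A : ε → List (ℕ × ℕ)} (hR : PT R) (hA : PT A) :
    PT fun e => cost (R e) (A e) := by
  unfold CapSteiner.cost
  -- Fractions are never reduced. Still, adding an arc multiplies the denominators, so the numbers
  -- of digits grow only additively.
  have hs : ∀ R (l : List (ℕ × ℕ)),
      (CapSteiner.cost R l).1.length ≤ l.length * (2 * esize R + 3) + 1 ∧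
      (CapSteiner.cost R l).2.length ≤ l.length * (2 * esize R + 3) + 1 := by
    intro R l
    induction l using List.reverseRecOn with
    | nil => simp [CapSteiner.cost]
    | append_singleton l a ih =>
      rw [CapSteiner.cost, List.foldl_append]
      change (CapSteiner.addFrac (CapSteiner.cost R l) (CapSteiner.arcLen R a)).1.length ≤ _ ∧
        (CapSteiner.addFrac (CapSteiner.cost R l) (CapSteiner.arcLen R a)).2.length ≤ _
      generalize CapSteiner.cost R l = s at ih ⊢
      have h1 := esize_arcLen_le R a
      generalize CapSteiner.arcLen R a = q at h1 ⊢
      have h2 := length_badd_le (CapSteiner.bmul q.2 s.1) (CapSteiner.bmul q.1 s.2) false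
      have h3 := length_bmul_le q.2 s.1
      have h4 := length_bmul_le q.1 s.2
      have h5 := length_bmul_le q.2 s.2
      rw [List.length_append, List.length_singleton, add_mul]
      simp only [CapSteiner.addFrac]
      omega
  refine PT.foldl
    (f := fun e s a => CapSteiner.addFrac s (CapSteiner.arcLen (R e) a)) hA
    (by fun_prop) (by fun_prop)
    (B := fun e => 8 * ((A e).length * (2 * esize (R e) + 3) + 1) + 3)
    (((PolyBdd.const 8).mul ((hA.polyBdd_length.mul (((PolyBdd.const 2).mul hR.polyBdd).add
      (PolyBdd.const 3))).add (PolyBdd.const 1))).add (PolyBdd.const 3)) fun e l₁ l₂ hl => ?_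
  have h1 := hs (R e) l₁
  have h2 := esize_bits_le (CapSteiner.cost (R e) l₁).1
  have h3 := esize_bits_le (CapSteiner.cost (R e) l₁).2
  have h4 : l₁.length ≤ (A e).length := by simp [hl]
  have h5 := Nat.mul_le_mul_right (2 * esize (R e) + 3) h4
  change esize (CapSteiner.cost (R e) l₁) ≤ _
  rw [esize_pair]
  omega

@[fun_prop] theorem better {R : ε → RawNetwork} {A B : ε → List (ℕ × ℕ)} (hR : PT R) (hA : PT A)
    (hB : PT B) : PT fun e => better (R e) (A e) (B e) := by
  unfold CapSteiner.better
  fun_prop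

@[fun_prop] theorem best {R : ε → RawNetwork} {l : ε → List (List (ℕ × ℕ))} (hR : PT R)
    (hl : PT l) : PT fun e => best (R e) (l e) := by
  unfold CapSteiner.best
  refine PT.foldl
    (f := fun e b A => b.elim (some A) fun B =>
      bif CapSteiner.better (R e) A B then some A else some B) hl
    (PT.const none) (by fun_prop) (B := fun e => esize (l e) + 2)
    (hl.polyBdd.add (PolyBdd.const 2)) fun e l₁ l₂ hl => ?_
  change esize (CapSteiner.best (R e) l₁) ≤ _
  cases h : CapSteiner.best (R e) l₁ with
  | none => simp
  | some A =>
    have := esize_le_of_mem (show A ∈ l e by simp [hl, best_mem h])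
    simp
    omega

-- Here `k` is a constant outside the computation: one program and one polynomial for each `k`.
@[fun_prop] theorem states {R : ε → RawNetwork} (hR : PT R) (k : ℕ) :
    PT fun e => states (R e) k := by
  induction k with
  | zero => exact PT.const _
  | succ k ih =>
    unfold CapSteiner.states
    have : PT fun p : ε × ℕ => CapSteiner.states (R p.1) k := ih.comp (PT.fst PT.id)
    fun_prop

@[fun_prop] theorem lookup {T : ε → Table} {x : ε → List ℕ} (hT : PT T) (hx : PT x) :
    PT fun e => lookup (T e) (x e) := by
  unfold CapSteiner.lookup
  fun_prop

@[fun_prop] theorem move {R : ε → RawNetwork} {T : ε → Table} {x : ε → List ℕ} {v : ε → ℕ}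
    (hR : PT R) (hT : PT T) (hx : PT x) (hv : PT v) :
    PT fun e => move (R e) (T e) (x e) (v e) := by
  unfold CapSteiner.move
  fun_prop

@[fun_prop] theorem tableStep {R : ε → RawNetwork} {T : ε → Table} {v : ε → ℕ}
    (hR : PT R) (k : ℕ) (hT : PT T) (hv : PT v) :
    PT fun e => tableStep (R e) k (T e) (v e) := by
  unfold CapSteiner.tableStep
  fun_prop

@[fun_prop] theorem tableInit {R : ε → RawNetwork} (hR : PT R) (k : ℕ) :
    PT fun e => tableInit (R e) k := by
  unfold CapSteiner.tableInit
  fun_prop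

@[fun_prop] theorem table {R : ε → RawNetwork} {o : ε → List ℕ} (hR : PT R) (k : ℕ)
    (ho : PT o) : PT fun e => table (R e) k (o e) := by
  have hn : PolyBdd fun e => (R e).1.length := hR.fst.polyBdd_length
  have hS := hR.states k
  unfold CapSteiner.table
  refine PT.foldl (f := fun e T v => CapSteiner.tableStep (R e) k T v) ho
    (by fun_prop) (by fun_prop)
    (B := fun e => (CapSteiner.states (R e) k).length * ((esize (CapSteiner.states (R e) k) +
      (1 + (o e).length * (2 * (R e).1.length + esize (o e) + 3)) + 3) + 1) + 1)
    ((hS.polyBdd_length.mul (((hS.polyBdd.add ((PolyBdd.const 1).add (ho.polyBdd_length.mul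
      ((((PolyBdd.const 2).mul hn).add ho.polyBdd).add (PolyBdd.const 3))))).add
      (PolyBdd.const 3)).add (PolyBdd.const 1))).add (PolyBdd.const 1)) fun e l₁ l₂ hl => ?_
  change esize (CapSteiner.table (R e) k l₁) ≤ _
  rw [← length_table (R e) k l₁]
  refine esize_le_of_forall fun p hp => ?_
  have h1 := esize_le_of_mem (mem_fst_table hp)
  rw [esize_pair]
  obtain ⟨x, _ | A⟩ := p
  · simp only [esize_none] at *
    omega
  · have h2 := esize_table_le (N := esize (o e)) l₁
      (fun v hv => esize_le_of_mem (by simp [hl, hv])) hp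
    have h4 : l₁.length ≤ (o e).length := by simp [hl]
    have h5 := Nat.mul_le_mul_right (2 * (R e).1.length + esize (o e) + 3) h4
    simp only [esize_some] at *
    omega

@[fun_prop] theorem isSeed {R : ε → RawNetwork} {x : ε → List ℕ} (hR : PT R) (κ : ℕ)
    (hx : PT x) : PT fun e => isSeed (R e) κ (x e) := by
  unfold CapSteiner.isSeed
  fun_prop

@[fun_prop] theorem seedTree (κ : ℕ) {R : ε → RawNetwork} (hR : PT R) :
    PT fun e => seedTree κ (R e) := by
  unfold CapSteiner.seedTree
  fun_prop

@[fun_prop] theorem mergeTrees {R : ε → RawNetwork} {A : ε → List (ℕ × ℕ)}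
    {N : ε → List (List Bool)} (hR : PT R) (hA : PT A) (hN : PT N) :
    PT fun e => mergeTrees (R e) (A e) (N e) := by
  unfold CapSteiner.mergeTrees
  fun_prop

end PT

end AlgorithmPT

open RootedNetwork

/-! ### Small certificates of feasibility -/

section Laminar

variable {V : Type} [DecidableEq V]

/-- Among the members that miss part of `T`, let `B` have the largest trace on `T`; take `b ∈ T \ B`
and `a ∈ T ∩ B`. A member `C` that misses part of `T` cannot contain both: sharing `a` with `B` it
would be comparable to `B`, and containing `b` it would have a larger trace. -/
theorem exists_two_witnesses (T : Finset V) (F : Finset (Finset V))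
    (hF : ∀ B ∈ F, ∀ C ∈ F, ∀ t, t ∈ B → t ∈ C → B ⊆ C ∨ C ⊆ B) :
    ∃ W ⊆ T, W.card ≤ 2 ∧ ∀ B ∈ F, (T \ B).Nonempty → (W \ B).Nonempty := by
  classical
  by_cases hne : (F.filter fun B => (T \ B).Nonempty).Nonempty
  · obtain ⟨B, hB, hmax⟩ := Finset.exists_max_image _ (fun B => (T ∩ B).card) hne
    rw [Finset.mem_filter] at hB
    obtain ⟨b, hb⟩ := hB.2
    rw [Finset.mem_sdiff] at hb
    have key : ∀ C ∈ F, (T \ C).Nonempty → b ∈ C → ∀ a ∈ T, a ∈ B → a ∉ C := by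
      intro C hC hTC hbC a haT haB haC
      rcases hF B hB.1 C hC a haB haC with h | h
      · refine (hmax C (by simp [hC, hTC])).not_gt (Finset.card_lt_card ?_)
        rw [Finset.ssubset_iff_of_subset (Finset.inter_subset_inter_left h)]
        exact ⟨b, by simp [hb, hbC]⟩
      · exact hb.2 (h hbC)
    by_cases hTB : (T ∩ B).Nonempty
    · obtain ⟨a, ha⟩ := hTB
      rw [Finset.mem_inter] at ha
      refine ⟨{a, b}, by simp [Finset.insert_subset_iff, ha, hb], Finset.card_le_two,
        fun C hC hTC => ?_⟩
      by_cases hbC : b ∈ C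
      · exact ⟨a, by simp [key C hC hTC hbC a ha.1 ha.2]⟩
      · exact ⟨b, by simp [hbC]⟩
    -- The largest trace is empty, so every trace is, and `b` alone suffices.
    · refine ⟨{b}, by simp [hb], by simp, fun C hC hTC => ⟨b, ?_⟩⟩
      by_cases hbC : b ∈ C
      · have h1 := hmax C (by simp [hC, hTC])
        rw [Finset.not_nonempty_iff_eq_empty.1 hTB, Finset.card_empty, Nat.le_zero,
          Finset.card_eq_zero] at h1
        have : b ∈ T ∩ C := by simp [hb, hbC]
        simp [h1] at this
      · simp [hbC]
  · refine ⟨∅, by simp, by simp, fun B hB h => (hne ⟨B, by simp [hB, h]⟩).elim⟩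

/-- Take two witnesses and continue with the other terminals. Every `B` that misses part of `T`
misses a witness in the first round, so each round raises the guaranteed number of elements outside
`B` by one until `T \ B` is exhausted. -/
theorem exists_small_witness (κ : ℕ) (T : Finset V) (F : Finset (Finset V))
    (hF : ∀ B ∈ F, ∀ C ∈ F, ∀ t, t ∈ B → t ∈ C → B ⊆ C ∨ C ⊆ B) :
    ∃ W ⊆ T, W.card ≤ 2 * κ ∧ ∀ B ∈ F, min κ (T \ B).card ≤ (W \ B).card := by
  induction κ generalizing T with
  | zero => exact ⟨∅, by simp⟩
  | succ κ ih =>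
    obtain ⟨W₁, h₁, hc₁, hw₁⟩ := exists_two_witnesses T F hF
    obtain ⟨W₂, h₂, hc₂, hw₂⟩ := ih (T \ W₁)
    refine ⟨W₁ ∪ W₂, Finset.union_subset h₁ (h₂.trans Finset.sdiff_subset),
      (Finset.card_union_le _ _).trans (by omega), fun B hB => ?_⟩
    have hd : Disjoint (W₁ \ B) (W₂ \ B) :=
      (Finset.disjoint_of_subset_right h₂ Finset.disjoint_sdiff).mono Finset.sdiff_subset
        Finset.sdiff_subset
    rw [Finset.union_sdiff_distrib, Finset.card_union_of_disjoint hd]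
    rcases (T \ B).eq_empty_or_nonempty with h | h
    · simp [h]
    · have h3 := (hw₁ B hB h).card_pos
      have h4 := hw₂ B hB
      have h5 : (T \ B).card ≤ (W₁ \ B).card + ((T \ W₁) \ B).card := by
        rw [← Finset.card_union_of_disjoint]
        · refine Finset.card_le_card fun t ht => ?_
          simp only [Finset.mem_union, Finset.mem_sdiff] at ht ⊢
          tauto
        · exact Finset.disjoint_sdiff.mono Finset.sdiff_subset Finset.sdiff_subset
      omega

end Laminar

/-! ### Directed trees. -/

section Trees

variable {I : RootedNetwork} {S : Finset (Fin I.n × Fin I.n)}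

/-- At most one arc enters each vertex, so walking backwards from `t` is deterministic. This makes
the sets below arcs laminar. -/
theorem RootedNetwork.IsTree.linked_total (hS : I.IsTree S) {v w t : Fin I.n}
    (hv : Linked S v t) (hw : Linked S w t) : Linked S v w ∨ Linked S w v := by
  have hu : Relator.RightUnique (Function.swap fun a b : Fin I.n => (a, b) ∈ S) :=
    fun a b c hb hc => congrArg Prod.fst (hS.unique_entry _ hb _ hc rfl)
  rcases Relation.ReflTransGen.total_of_right_unique hu hv.swap hw.swap with h | h
  · exact Or.inr (by simpa [Linked] using h.swap)
  · exact Or.inl (by simpa [Linked] using h.swap)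

/-- Every vertex other than the root chooses a predecessor. By acyclicity, following the choices
backwards ends, and it can only end at the root. -/
theorem RootedNetwork.exists_isSteinerTree (hI : I.IsDAG) : ∃ S, I.IsSteinerTree S := by
  classical
  have hp : ∀ v, v ≠ I.root → ∃ u, I.G.Adj u v := by
    intro v hv
    rcases Relation.ReflTransGen.cases_tail (I.reach v) with h | ⟨u, -, h⟩
    · exact (hv h).elim
    · exact ⟨u, h⟩
  choose! p hp using hp
  let S : Finset (Fin I.n × Fin I.n) :=
    Finset.univ.filter fun a => a.2 ≠ I.root ∧ a.1 = p a.2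
  have hlinked : ∀ v, Linked S I.root v := by
    have : Std.Irrefl (Relation.TransGen I.G.Adj) := ⟨hI⟩
    have hwf : WellFounded (Relation.TransGen I.G.Adj) :=
      Finite.wellFounded_of_trans_of_irrefl _
    intro v
    induction v using hwf.induction with
    | _ v ih =>
      by_cases hv : v = I.root
      · rw [hv]
        exact Relation.ReflTransGen.refl
      · exact (ih _ (Relation.TransGen.single (hp v hv))).tail (by simp [S, hv])
  refine ⟨S, ⟨?_, ?_, ?_, fun a _ => hlinked _⟩, fun t _ => hlinked t⟩
  · rintro ⟨u, v⟩ ha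
    simp only [S, Finset.mem_filter, Finset.mem_univ, true_and] at ha
    rw [ha.2]
    exact hp v ha.1
  · intro a ha
    simp only [S, Finset.mem_filter, Finset.mem_univ, true_and] at ha
    exact ha.1
  · rintro ⟨a, c⟩ ha ⟨b, d⟩ hb hab
    simp only [S, Finset.mem_filter, Finset.mem_univ, true_and] at ha hb hab
    rw [ha.2, hb.2, hab]

end Trees

/-! ### Certificates: extraction, merging, and attachment of leaves. -/

section Certificates

open Classical in
/-- A tree that contains the list `x` of tokens, such that for each arc enough tokens are not
below this arc. -/
structure CapInstance.IsCertificate (I : CapInstance) (x : List (Fin I.n))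
    (S : Finset (Fin I.n × Fin I.n)) : Prop where
  tree : I.IsTree S
  linked : ∀ t ∈ x, Linked S I.root t
  le_cap : ∀ a ∈ S, I.terminals.card + x.countP (fun t => decide (Linked S a.2 t)) ≤
    x.length + I.cap a.1 a.2

/-- A list of distinct terminals that is large enough to certify feasibility. -/
structure CapInstance.IsSeedList (I : CapInstance) (κ : ℕ) (x : List (Fin I.n)) : Prop where
  nodup : x.Nodup
  terminal : ∀ t ∈ x, t ∈ I.terminals
  le_length : κ ≤ x.length ∨ I.terminals.card ≤ x.length

/-- The tokens are the witnesses for the terminal sets below the arcs. Outside an arc there are at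
least `κ` of them or as many as there are terminals outside; both numbers are at least `K - c`. -/
theorem CapInstance.IsFeasible.exists_certificate {I : CapInstance} {κ : ℕ}
    (hI : I.IsLargeCapDAG κ) {S : Finset (Fin I.n × Fin I.n)} (hS : I.IsFeasible S) :
    ∃ x, I.IsSeedList κ x ∧ x.length ≤ 2 * κ ∧ I.IsCertificate x S := by
  classical
  let below : Fin I.n × Fin I.n → Finset (Fin I.n) :=
    fun a => I.terminals.filter fun t => Linked S a.2 t
  -- The empty set is added to the family in order to get `min κ K ≤ |W|`, the size condition on
  -- seed lists.
  obtain ⟨W, hW, hcard, hw⟩ := exists_small_witness κ I.terminals (insert ∅ (S.image below)) (by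
    intro B hB C hC t htB htC
    simp only [Finset.mem_insert, Finset.mem_image] at hB hC
    rcases hB with rfl | ⟨a, -, rfl⟩
    · simp at htB
    rcases hC with rfl | ⟨b, -, rfl⟩
    · simp at htC
    simp only [below, Finset.mem_filter] at htB htC
    rcases hS.1.1.linked_total htB.2 htC.2 with h | h
    · right
      intro s hs
      simp only [below, Finset.mem_filter] at hs ⊢
      exact ⟨hs.1, Relation.ReflTransGen.trans h hs.2⟩
    · left
      intro s hs
      simp only [below, Finset.mem_filter] at hs ⊢
      exact ⟨hs.1, Relation.ReflTransGen.trans h hs.2⟩)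
  refine ⟨W.toList, ⟨W.nodup_toList, fun t ht => hW (by simpa using ht), ?_⟩, by simpa using hcard,
    hS.1.1, fun t ht => hS.1.2 t (hW (by simpa using ht)), fun a ha => ?_⟩
  · have := hw ∅ (by simp)
    simp only [Finset.sdiff_empty] at this
    rw [Finset.length_toList]
    omega
  · have h1 := hw (below a) (by
      simp only [Finset.mem_insert, Finset.mem_image]
      exact Or.inr ⟨a, ha, rfl⟩)
    have h2 : I.terminals.card ≤ I.cap a.1 a.2 + (I.terminals \ below a).card := by
      have := hS.2 a ha
      have h3 : (below a).card ≤ I.cap a.1 a.2 := by convert this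
      have : (I.terminals \ below a).card + (below a).card = I.terminals.card :=
        Finset.card_sdiff_add_card_eq_card (Finset.filter_subset _ _)
      omega
    have h3 := hI.2 a.1 a.2 (hS.1.1.adj a ha)
    have h4 : W.toList.countP (fun t => decide (Linked S a.2 t)) =
        (W.filter fun t => Linked S a.2 t).card := by
      rw [← Finset.length_toList, List.countP_eq_length_filter]
      refine (List.Perm.length_eq ?_)
      rw [List.perm_ext_iff_of_nodup (W.nodup_toList.filter _) (Finset.nodup_toList _)]
      simp
    have h5 : W \ below a = W \ (W.filter fun t => Linked S a.2 t) := by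
      ext t
      simp only [below, Finset.mem_sdiff, Finset.mem_filter]
      constructor
      · rintro ⟨h, h'⟩
        exact ⟨h, fun h'' => h' ⟨hW h, h''.2⟩⟩
      · rintro ⟨h, h'⟩
        exact ⟨h, fun h'' => h' ⟨h, h''.2⟩⟩
    have h6 := Finset.card_sdiff_add_card_eq_card
      (Finset.filter_subset (fun t => Linked S a.2 t) W)
    rw [h4, Finset.length_toList]
    rw [h5] at h1
    omega

/-- The union of a tree with the arcs of another one that enter none of its vertices. -/
def mergeArcs {n : ℕ} (A B : Finset (Fin n × Fin n)) : Finset (Fin n × Fin n) :=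
  A ∪ B.filter fun b => ∀ a ∈ A, a.2 ≠ b.2

/-- Tokens are reached through arcs of `A` only. An arc of `A` thus keeps its tokens outside, and an
arc of `B` has all tokens outside; there are enough of them since `x` is a seed list. -/
theorem CapInstance.IsCertificate.isFeasible_mergeArcs {I : CapInstance} {κ : ℕ}
    (hI : I.IsLargeCapDAG κ) {x : List (Fin I.n)} (hx : I.IsSeedList κ x)
    {A B : Finset (Fin I.n × Fin I.n)} (hA : I.IsCertificate x A) (hB : I.IsSteinerTree B) :
    I.IsFeasible (mergeArcs A B) := by
  classical
  have hmem : ∀ {b}, b ∈ mergeArcs A B ↔ b ∈ A ∨ (b ∈ B ∧ ∀ a ∈ A, a.2 ≠ b.2) := by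
    intro b
    simp [mergeArcs]
  have hAS : ∀ {u v}, Linked A u v → Linked (mergeArcs A B) u v := by
    intro u v h
    exact Relation.ReflTransGen.mono (fun a b hab => hmem.2 (Or.inl hab)) _ _ h
  have hend : ∀ {v}, Linked A I.root v → v = I.root ∨ ∃ a ∈ A, a.2 = v := by
    intro v h
    rcases Relation.ReflTransGen.cases_tail h with h | ⟨u, -, h⟩
    · exact Or.inl h
    · exact Or.inr ⟨_, h, rfl⟩
  have hhead : ∀ {a}, a ∈ A → Linked A I.root a.2 := fun {a} ha =>
    (hA.tree.linked a ha).tail ha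
  -- Follow the path in `B`; at a vertex entered by `A`, switch to the path of `A` from the root.
  have hlink : ∀ {v}, Linked B I.root v → Linked (mergeArcs A B) I.root v := by
    intro v h
    induction h with
    | refl => exact Relation.ReflTransGen.refl
    | tail _ h ih =>
      rename_i b c _
      by_cases hc : ∃ a ∈ A, a.2 = c
      · obtain ⟨a, ha, rfl⟩ := hc
        exact hAS (hhead ha)
      · push Not at hc
        exact ih.tail (hmem.2 (Or.inr ⟨h, hc⟩))
  have htree : I.IsTree (mergeArcs A B) := by
    refine ⟨fun a ha => ?_, fun a ha => ?_, fun a ha b hb hab => ?_, fun a ha => ?_⟩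
    · rcases hmem.1 ha with h | h
      exacts [hA.tree.adj a h, hB.1.adj a h.1]
    · rcases hmem.1 ha with h | h
      exacts [hA.tree.root_no_entry a h, hB.1.root_no_entry a h.1]
    · rcases hmem.1 ha with h | h <;> rcases hmem.1 hb with h' | h'
      · exact hA.tree.unique_entry a h b h' hab
      · exact (h'.2 a h hab).elim
      · exact (h.2 b h' hab.symm).elim
      · exact hB.1.unique_entry a h.1 b h'.1 hab
    · rcases hmem.1 ha with h | h
      exacts [hAS (hA.tree.linked a h), hlink (hB.1.linked a h.1)]
  -- The last arc of a path to a vertex of `A` lies in `A`, for added arcs enter no vertex of `A`;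
  -- its tail is again a vertex of `A`.
  have hback : ∀ {v t}, Linked (mergeArcs A B) v t → Linked A I.root t → Linked A v t := by
    intro v t h
    induction h with
    | refl => exact fun _ => Relation.ReflTransGen.refl
    | tail _ h ih =>
      rename_i b c _
      intro hc
      have hbc : (b, c) ∈ A := by
        rcases hmem.1 h with h' | h'
        · exact h'
        · rcases hend hc with h'' | ⟨a, ha, h''⟩
          · exact (htree.root_no_entry _ h h'').elim
          · exact (h'.2 a ha h'').elim
      exact (ih (hA.tree.linked _ hbc)).tail hbc
  refine ⟨⟨htree, fun t ht => hlink (hB.2 t ht)⟩, fun a ha => ?_⟩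
  have hcount : x.countP (fun t => decide (Linked (mergeArcs A B) a.2 t)) + I.terminals.card ≤
      x.length + I.cap a.1 a.2 := by
    have : x.countP (fun t => decide (Linked (mergeArcs A B) a.2 t)) =
        x.countP (fun t => decide (Linked A a.2 t)) := by
      refine List.countP_congr fun t ht => ?_
      simp only [decide_eq_true_iff]
      exact ⟨fun h => hback h (hA.linked t ht), hAS⟩
    rw [this]
    rcases hmem.1 ha with h | h
    · rw [add_comm]
      exact hA.le_cap a h
    -- A token below an added arc would make the head of this arc a vertex of `A`.
    · have h0 : x.countP (fun t => decide (Linked A a.2 t)) = 0 := by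
        rw [List.countP_eq_zero]
        intro t ht
        simp only [decide_eq_true_iff]
        intro hat
        have : Linked A I.root a.2 := by
          rcases Relation.ReflTransGen.cases_head hat with h' | ⟨c, h', -⟩
          · rw [h']
            exact hA.linked t ht
          · exact hA.tree.linked _ h'
        rcases hend this with h' | ⟨b, hb, h'⟩
        · exact hB.1.root_no_entry a h.1 h'
        · exact h.2 b hb h'
      have h1 := hI.2 a.1 a.2 (htree.adj a ha)
      rcases hx.le_length with h2 | h2 <;> omega
  -- The tokens are distinct terminals, so those outside `a` bound from below the number of
  -- terminals outside `a`.
  have h1 : x.toFinset.filter (fun t => ¬ Linked (mergeArcs A B) a.2 t) ⊆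
      I.terminals.filter (fun t => ¬ Linked (mergeArcs A B) a.2 t) := by
    refine Finset.filter_subset_filter _ fun t ht => hx.terminal t (by simpa using ht)
  have h2 := Finset.card_le_card h1
  have h3 := Finset.card_filter_add_card_filter_not (s := I.terminals)
    (fun t => Linked (mergeArcs A B) a.2 t)
  have h4 := Finset.card_filter_add_card_filter_not (s := x.toFinset)
    (fun t => Linked (mergeArcs A B) a.2 t)
  rw [List.toFinset_card_of_nodup hx.nodup, List.filter_toFinset,
    List.toFinset_card_of_nodup (hx.nodup.filter _), ← List.countP_eq_length_filter] at h4
  have h5 : (I.terminals.filter fun t => Linked (mergeArcs A B) a.2 t).card ≤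
      I.cap a.1 a.2 := by omega
  convert h5

/-- A new leaf `v` hung on `u` is reached exactly when `u` is. For all other arcs, tokens at `v`
thus behave like tokens at `u`. -/
theorem linked_insert {n : ℕ} {S : Finset (Fin n × Fin n)} {u v : Fin n} (huv : u ≠ v)
    (hv : ∀ a ∈ S, a.1 ≠ v ∧ a.2 ≠ v) {a : Fin n} (ha : a ≠ v) (b : Fin n) :
    Linked (insert (u, v) S) a b ↔ Linked S a (if b = v then u else b) := by
  constructor
  · intro h
    induction h with
    | refl => rw [if_neg ha]; exact Relation.ReflTransGen.refl
    | tail _ h ih =>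
      rename_i b c _
      rcases Finset.mem_insert.1 h with h | h
      · rw [Prod.mk.injEq] at h
        rw [h.1, if_neg huv] at ih
        rwa [if_pos h.2]
      · rw [if_neg (hv _ h).1] at ih
        rw [if_neg (hv _ h).2]
        exact ih.tail h
  · intro h
    have hm : ∀ c, Linked S a c → Linked (insert (u, v) S) a c := fun c hc =>
      Relation.ReflTransGen.mono (fun p q hpq => Finset.mem_insert_of_mem hpq) _ _ hc
    by_cases hb : b = v
    · rw [if_pos hb] at h
      rw [hb]
      exact (hm u h).tail (Finset.mem_insert_self _ _)
    · rw [if_neg hb] at h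
      exact hm b h

theorem linked_insert_self {n : ℕ} {S : Finset (Fin n × Fin n)} {u v : Fin n} (huv : u ≠ v)
    (hv : ∀ a ∈ S, a.1 ≠ v ∧ a.2 ≠ v) (b : Fin n) :
    Linked (insert (u, v) S) v b ↔ b = v := by
  constructor
  · intro h
    rcases Relation.ReflTransGen.cases_head h with h | ⟨c, h, -⟩
    · exact h.symm
    · rcases Finset.mem_insert.1 h with h | h
      · exact (huv (congrArg Prod.fst h).symm).elim
      · exact ((hv _ h).1 rfl).elim
  · rintro rfl
    exact Relation.ReflTransGen.refl

variable {I : CapInstance} {x : List (Fin I.n)} {S : Finset (Fin I.n × Fin I.n)} {u v : Fin I.n}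

/-- The only tokens below the new arc are those at `v`, so `hcap` is its capacity condition. The
other arcs see the moved tokens, and the length of the list is unchanged because repetitions are
kept. -/
theorem CapInstance.IsCertificate.insert_arc (huv : u ≠ v) (hv : ∀ a ∈ S, a.1 ≠ v ∧ a.2 ≠ v)
    (hS : I.IsCertificate (x.map fun y => if y = v then u else y) S) (hadj : I.G.Adj u v)
    (hroot : v ≠ I.root) (hu : Linked S I.root u)
    (hcap : I.terminals.card + x.count v ≤ x.length + I.cap u v) :
    I.IsCertificate x (insert (u, v) S) := by
  classical
  refine ⟨⟨?_, ?_, ?_, ?_⟩, fun t ht => ?_, ?_⟩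
  · intro a ha
    rcases Finset.mem_insert.1 ha with rfl | ha
    exacts [hadj, hS.tree.adj a ha]
  · intro a ha
    rcases Finset.mem_insert.1 ha with rfl | ha
    exacts [hroot, hS.tree.root_no_entry a ha]
  · intro a ha b hb hab
    rcases Finset.mem_insert.1 ha with rfl | ha <;> rcases Finset.mem_insert.1 hb with rfl | hb
    · rfl
    · exact ((hv b hb).2 hab.symm).elim
    · exact ((hv a ha).2 hab).elim
    · exact hS.tree.unique_entry a ha b hb hab
  · intro a ha
    rw [linked_insert huv hv hroot.symm]
    rcases Finset.mem_insert.1 ha with rfl | ha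
    · rwa [if_neg huv]
    · rw [if_neg (hv a ha).1]
      exact hS.tree.linked a ha
  · rw [linked_insert huv hv hroot.symm]
    exact hS.linked _ (List.mem_map_of_mem ht)
  · intro a ha
    rcases Finset.mem_insert.1 ha with rfl | ha
    · simpa [linked_insert_self huv hv, List.count, beq_eq_decide] using hcap
    · have := hS.le_cap a ha
      rw [List.length_map, List.countP_map] at this
      simp only [linked_insert huv hv (hv a ha).2]
      exact this

theorem CapInstance.IsCertificate.of_insert_arc (huv : u ≠ v) (hv : ∀ a ∈ S, a.1 ≠ v ∧ a.2 ≠ v)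
    (hS : I.IsCertificate x (insert (u, v) S)) :
    I.IsCertificate (x.map fun y => if y = v then u else y) S ∧ I.G.Adj u v ∧
      I.terminals.card + x.count v ≤ x.length + I.cap u v := by
  classical
  have hroot : v ≠ I.root := hS.tree.root_no_entry _ (Finset.mem_insert_self _ _)
  refine ⟨⟨⟨?_, ?_, ?_, ?_⟩, fun t ht => ?_, ?_⟩, ?_, ?_⟩
  · exact fun a ha => hS.tree.adj a (Finset.mem_insert_of_mem ha)
  · exact fun a ha => hS.tree.root_no_entry a (Finset.mem_insert_of_mem ha)
  · exact fun a ha b hb => hS.tree.unique_entry a (Finset.mem_insert_of_mem ha) b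
      (Finset.mem_insert_of_mem hb)
  · intro a ha
    have := hS.tree.linked a (Finset.mem_insert_of_mem ha)
    rwa [linked_insert huv hv hroot.symm, if_neg (hv a ha).1] at this
  · obtain ⟨y, hy, rfl⟩ := List.mem_map.1 ht
    rw [← linked_insert huv hv hroot.symm]
    exact hS.linked y hy
  · intro a ha
    have := hS.le_cap a (Finset.mem_insert_of_mem ha)
    simp only [linked_insert huv hv (hv a ha).2] at this
    rw [List.length_map, List.countP_map]
    exact this
  · exact hS.tree.adj _ (Finset.mem_insert_self _ _)
  · have := hS.le_cap _ (Finset.mem_insert_self _ _)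
    simpa [linked_insert_self huv hv, List.count, beq_eq_decide] using this

end Certificates

/-! ### Correctness of the algorithm -/

section Weights

/-- The total length of a list of arcs, as a rational number. -/
def weight (R : RawNetwork) (A : List (ℕ × ℕ)) : ℚ≥0 :=
  (bval (cost R A).1 : ℚ≥0) / (bval (cost R A).2 : ℚ≥0)

/-- Fractions are compared by cross-multiplication, which is meaningful only for nonzero
denominators; hence the side conditions on candidates below. -/
theorem better_iff {R : RawNetwork} {A B : List (ℕ × ℕ)} (hA : bval (cost R A).2 ≠ 0)
    (hB : bval (cost R B).2 ≠ 0) : better R A B = true ↔ weight R A ≤ weight R B := by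
  rw [better, ble_iff, bval_bmul, bval_bmul, weight, weight,
    div_le_div_iff₀ (by positivity) (by positivity)]
  norm_cast
  simp [le_iff_lt_or_eq]

theorem best_le {R : RawNetwork} {l : List (List (ℕ × ℕ))} (hl : ∀ A ∈ l, bval (cost R A).2 ≠ 0)
    {B : List (ℕ × ℕ)} (hB : B ∈ l) : ∃ A, best R l = some A ∧ weight R A ≤ weight R B := by
  induction l using List.reverseRecOn generalizing B with
  | nil => simp at hB
  | append_singleton l C ih =>
    have hstep : best R (l ++ [C]) = (best R l).elim (some C) fun D =>
        bif better R C D then some C else some D := by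
      rw [best, List.foldl_append]
      rfl
    have ih := fun B hB => @ih (fun A hA => hl A (by simp [hA])) B hB
    have hC := hl C (by simp)
    rw [hstep]
    cases hb : best R l with
    | none =>
      rw [best_eq_none_iff] at hb
      subst hb
      simp at hB
      exact ⟨C, rfl, by rw [hB]⟩
    | some D =>
      have hD := hl D (by simp [best_mem hb])
      have hbet := better_iff hC hD
      simp only [hb, Option.some.injEq, exists_eq_left'] at ih
      rw [Option.elim_some]
      cases h : better R C D with
      | true =>
        rw [h] at hbet
        refine ⟨C, rfl, ?_⟩
        rcases List.mem_append.1 hB with hB | hB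
        · exact (hbet.1 rfl).trans (ih B hB)
        · rw [List.mem_singleton.1 hB]
      | false =>
        rw [h] at hbet
        refine ⟨D, rfl, ?_⟩
        rcases List.mem_append.1 hB with hB | hB
        · exact ih B hB
        · rw [List.mem_singleton.1 hB]
          simp only [Bool.false_eq_true, false_iff, not_le] at hbet
          exact hbet.le

end Weights

theorem mem_states_iff {R : RawNetwork} {k : ℕ} {x : List ℕ} :
    x ∈ states R k ↔ x.length ≤ k ∧ ∀ v ∈ x, v < R.1.length := by
  induction k generalizing x with
  | zero => cases x <;> simp [states]
  | succ k ih =>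
    cases x with
    | nil => simp [states]
    | cons v x =>
      simp [states, ih, verts]
      tauto

theorem lookup_map {l : List (List ℕ)} (g : List ℕ → Option (List (ℕ × ℕ))) {x : List ℕ}
    (hx : x ∈ l) : lookup (l.map fun x => (x, g x)) x = g x := by
  rw [lookup, List.find?_map]
  cases h : l.find? ((fun p : List ℕ × Option (List (ℕ × ℕ)) => p.1 == x) ∘ fun x => (x, g x)) with
  | none => simpa using List.find?_eq_none.1 h x hx
  | some y =>
    have := List.find?_some h
    simp at this
    simp [this]

theorem lookup_table_append {R : RawNetwork} {k : ℕ} {o : List ℕ} {v : ℕ} {x : List ℕ}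
    (hx : x ∈ states R k) : lookup (table R k (o ++ [v])) x =
      bif isRoot R v || !(x.contains v) then lookup (table R k o) x
      else best R (move R (table R k o) x v) := by
  rw [table, List.foldl_append]
  exact lookup_map _ hx

/-! ### Instances as matrices, and the algorithm's primitives on them. -/

theorem encList_ofFn {α : Type} [Enc α] {n : ℕ} (f : Fin n → α) :
    Enc.enc (List.ofFn f) = encVec fun i => Enc.enc (f i) := by
  change encList ((List.ofFn f).map Enc.enc) = _
  rw [List.map_ofFn]
  rfl

/-- The `0-1` matrix of a set of arcs. -/
def arcMatrix {n : ℕ} (S : Finset (Fin n × Fin n)) : List (List Bool) :=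
  List.ofFn fun u => List.ofFn fun v => decide ((u, v) ∈ S)

theorem enc_arcMatrix {n : ℕ} (S : Finset (Fin n × Fin n)) :
    Enc.enc (arcMatrix S) = encArcs S := by
  simp only [arcMatrix, encList_ofFn]
  rfl

open Classical in
/-- The matrix of a digraph with data on its arcs. -/
noncomputable def digraphMatrix {α : Type} {n : ℕ} (G : Digraph (Fin n)) (w : Fin n → Fin n → α) :
    List (List (Option α)) :=
  List.ofFn fun u => List.ofFn fun v => if G.Adj u v then some (w u v) else none

theorem enc_digraphMatrix {α : Type} [Enc α] {n : ℕ} (G : Digraph (Fin n))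
    (w : Fin n → Fin n → α) :
    Enc.enc (digraphMatrix G w) = encDigraph G fun u v => Enc.enc (w u v) := by
  simp only [digraphMatrix, encList_ofFn, encDigraph]
  congr 1
  ext u
  congr 1
  ext v
  split_ifs <;> rfl

/-- The plain data of a network. -/
noncomputable def RootedNetwork.raw {α : Type} (I : RootedNetwork) (w : Fin I.n → Fin I.n → α) :
    List (List (Option α)) × List Bool × List Bool :=
  (digraphMatrix I.G w, List.ofFn fun v => decide (v ∈ ({I.root} : Finset (Fin I.n))),
    List.ofFn fun v => decide (v ∈ I.terminals))

theorem RootedNetwork.enc_raw {α : Type} [Enc α] (I : RootedNetwork)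
    (w : Fin I.n → Fin I.n → α) :
    Enc.enc (I.raw w) = I.enc fun u v => Enc.enc (w u v) := by
  simp only [RootedNetwork.raw, enc_pair, enc_digraphMatrix, encList_ofFn]
  rfl

/-- Changing the data on the arcs passes between the problems: capacities are dropped for
STEINER-TREE, zero lengths are added for CAP-STEINER-TREE. -/
theorem RootedNetwork.raw_map {α β : Type} (I : RootedNetwork) (w : Fin I.n → Fin I.n → α)
    (f : α → β) :
    ((I.raw w).1.map fun row => row.map fun o => o.map f, (I.raw w).2) =
      I.raw fun u v => f (w u v) := by
  simp only [RootedNetwork.raw, digraphMatrix, List.map_ofFn, Prod.mk.injEq, and_true]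
  congr 1
  ext1 u
  simp only [Function.comp_apply, List.map_ofFn]
  congr 1
  ext1 v
  simp only [Function.comp_apply]
  split_ifs <;> rfl

/-- The plain data of an instance of ML-CAP-STEINER-TREE. -/
noncomputable def MLCapInstance.raw (I : MLCapInstance) : RawNetwork :=
  I.toRootedNetwork.raw fun u v => ((I.cap u v).bits, (I.len u v).num.bits, (I.len u v).den.bits)

theorem MLCapInstance.enc_raw (I : MLCapInstance) : Enc.enc I.raw = I.enc :=
  I.toRootedNetwork.enc_raw _

namespace MLCapInstance

variable (I : MLCapInstance)

/-- The pairs of numbers of a list of arcs. -/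
def vals {n : ℕ} (B : List (Fin n × Fin n)) : List (ℕ × ℕ) :=
  B.map fun a => ((a.1 : ℕ), (a.2 : ℕ))

theorem length_raw : I.raw.1.length = I.n := by
  simp [raw, RootedNetwork.raw, digraphMatrix]

open Classical in
theorem entry_raw (u v : Fin I.n) : entry I.raw u v = if I.G.Adj u v then
    some ((I.cap u v).bits, (I.len u v).num.bits, (I.len u v).den.bits) else none := by
  simp [entry, raw, RootedNetwork.raw, digraphMatrix]

theorem isRoot_raw (v : Fin I.n) : isRoot I.raw v = decide (v = I.root) := by
  simp [isRoot, raw, RootedNetwork.raw]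

theorem isTerm_raw (v : Fin I.n) : isTerm I.raw v = decide (v ∈ I.terminals) := by
  simp [isTerm, raw, RootedNetwork.raw]

theorem numTerm_raw : numTerm I.raw = I.terminals.card := by
  simp only [numTerm, raw, RootedNetwork.raw]
  rw [← List.countP_eq_length_filter, List.ofFn_eq_map, List.countP_map,
    List.countP_eq_length_filter, ← List.toFinset_card_of_nodup
      ((List.nodup_finRange _).filter _)]
  congr 1
  ext v
  simp

theorem mem_states_raw {k : ℕ} (y : List (Fin I.n)) (hy : y.length ≤ k) :
    y.map Fin.val ∈ states I.raw k := by
  rw [mem_states_iff, length_raw]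
  refine ⟨by simpa using hy, fun v hv => ?_⟩
  obtain ⟨w, -, rfl⟩ := List.mem_map.1 hv
  exact w.2

theorem exists_eq_map_of_mem_states {k : ℕ} {x : List ℕ} (hx : x ∈ states I.raw k) :
    ∃ y : List (Fin I.n), x = y.map Fin.val ∧ y.length ≤ k := by
  rw [mem_states_iff, length_raw] at hx
  have : x ∈ Set.range (List.map (Fin.val (n := I.n))) := by
    rw [Set.range_list_map]
    intro v hv
    exact ⟨⟨v, hx.2 v hv⟩, rfl⟩
  obtain ⟨y, rfl⟩ := this
  exact ⟨y, rfl, by simpa using hx.1⟩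

theorem weight_vals (B : List (Fin I.n × Fin I.n)) (hB : ∀ a ∈ B, I.G.Adj a.1 a.2) :
    bval (cost I.raw (vals B)).2 ≠ 0 ∧
      weight I.raw (vals B) = (B.map fun a => I.len a.1 a.2).sum := by
  induction B using List.reverseRecOn with
  | nil => simp [vals, weight, cost, bval]
  | append_singleton B a ih =>
    obtain ⟨ih1, ih2⟩ := ih fun b hb => hB b (by simp [hb])
    have ha := hB a (by simp)
    have hstep : cost I.raw (vals (B ++ [a])) =
        addFrac (cost I.raw (vals B)) ((I.len a.1 a.2).num.bits, (I.len a.1 a.2).den.bits) := by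
      rw [cost, vals, List.map_append, List.foldl_append]
      simp [arcLen, entry_raw, ha]
      rfl
    have hd := (I.len a.1 a.2).den_ne_zero
    have hd' : ((I.len a.1 a.2).den : ℚ≥0) ≠ 0 := by exact_mod_cast hd
    have ih1' : (bval (cost I.raw (vals B)).2 : ℚ≥0) ≠ 0 := by exact_mod_cast ih1
    rw [weight, hstep, List.map_append, List.sum_append, ← ih2, weight]
    simp only [addFrac, bval_badd, bval_bmul, bval_bits]
    refine ⟨mul_ne_zero hd ih1, ?_⟩
    have hq := NNRat.num_div_den (I.len a.1 a.2)
    simp only [List.map_cons, List.map_nil, List.sum_cons, List.sum_nil, add_zero, Nat.cast_add,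
      Nat.cast_mul, Bool.toNat_false]
    conv_rhs => rw [← hq]
    field_simp

theorem mapVal_move (y : List (Fin I.n)) (u v : Fin I.n) :
    ((y.map Fin.val).map fun z => bif z == (v : ℕ) then (u : ℕ) else z) =
      (y.map fun z => if z = v then u else z).map Fin.val := by
  rw [List.map_map, List.map_map]
  refine List.map_congr_left fun z _ => ?_
  by_cases h : z = v
  · simp [h]
  · have h' : (z : ℕ) ≠ v := Fin.val_ne_of_ne h
    simp only [Function.comp_apply, beq_eq_false_iff_ne.2 h', cond_false, if_neg h]

theorem contains_map (y : List (Fin I.n)) (v : Fin I.n) :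
    (y.map Fin.val).contains (v : ℕ) = decide (v ∈ y) := by
  rw [Bool.eq_iff_iff]
  simp [Fin.val_inj]

theorem count_map (y : List (Fin I.n)) (v : Fin I.n) :
    (y.map Fin.val).count (v : ℕ) = y.count v :=
  List.count_map_of_injective _ _ Fin.val_injective _

/-! ### Topological orders and correctness of the table. -/

/-- An initial segment of a topological order. -/
inductive IsTopo : List (Fin I.n) → Prop
  | nil : IsTopo []
  | snoc {o : List (Fin I.n)} {v : Fin I.n} (ho : IsTopo o) (hv : v ∉ o)
      (hpred : ∀ u, I.G.Adj u v → u ∈ o) : IsTopo (o ++ [v])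

variable {I}

theorem IsTopo.nodup {o : List (Fin I.n)} (ho : I.IsTopo o) : o.Nodup := by
  induction ho with
  | nil => simp
  | snoc _ hv _ ih => exact List.nodup_append'.2 ⟨ih, by simp, by simpa using hv⟩

theorem IsTopo.mem_of_adj {o : List (Fin I.n)} (ho : I.IsTopo o) {u v : Fin I.n}
    (h : I.G.Adj u v) (hv : v ∈ o) : u ∈ o := by
  induction ho with
  | nil => simp at hv
  | snoc _ _ hpred ih =>
    rw [List.mem_append, List.mem_singleton] at hv ⊢
    rcases hv with hv | rfl
    · exact Or.inl (ih hv)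
    · exact Or.inl (hpred u h)

/-- If no vertex is eligible, well-founded induction along the arcs shows that every vertex is
already listed. -/
theorem nextVert_spec (hI : I.IsDAG) (o : List (Fin I.n)) :
    (∃ v : Fin I.n, nextVert I.raw (o.map Fin.val) = some (v : ℕ) ∧ v ∉ o ∧
      ∀ u, I.G.Adj u v → u ∈ o) ∨
    (nextVert I.raw (o.map Fin.val) = none ∧ ∀ v, v ∈ o) := by
  have hiff : ∀ v : Fin I.n, (!((o.map Fin.val).contains (v : ℕ)) &&
      (verts I.raw).all fun u => (entry I.raw u v).isNone ||
        (o.map Fin.val).contains u) = true ↔ v ∉ o ∧ ∀ u, I.G.Adj u v → u ∈ o := by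
    intro v
    rw [contains_map, Bool.and_eq_true]
    simp only [Bool.not_eq_true', decide_eq_false_iff_not, List.all_eq_true, Bool.or_eq_true]
    refine and_congr_right fun _ => ⟨fun h u huv => ?_, fun h u hu => ?_⟩
    · have := h u (by simp [verts, length_raw])
      rw [contains_map, entry_raw, if_pos huv] at this
      simpa using this
    · simp only [verts, length_raw, List.mem_range] at hu
      have := h ⟨u, hu⟩
      have h1 := contains_map I o ⟨u, hu⟩
      have h2 := entry_raw I ⟨u, hu⟩ v
      simp only at h1 h2
      rw [h1, h2]
      by_cases huv : I.G.Adj ⟨u, hu⟩ v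
      · right
        simpa using this huv
      · left
        simp [huv]
  cases h : nextVert I.raw (o.map Fin.val) with
  | some v =>
    have h1 := List.mem_of_find?_eq_some h
    have h2 := List.find?_some h
    simp only [verts, length_raw, List.mem_range] at h1
    exact Or.inl ⟨⟨v, h1⟩, rfl, (hiff ⟨v, h1⟩).1 h2⟩
  | none =>
    refine Or.inr ⟨rfl, ?_⟩
    have h1 := List.find?_eq_none.1 h
    have hnot : ∀ v : Fin I.n, ¬ (v ∉ o ∧ ∀ u, I.G.Adj u v → u ∈ o) := by
      intro v hv
      exact h1 v (by simp [verts, length_raw]) ((hiff v).2 hv)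
    have : Std.Irrefl (Relation.TransGen I.G.Adj) := ⟨hI⟩
    have hwf : WellFounded (Relation.TransGen I.G.Adj) :=
      Finite.wellFounded_of_trans_of_irrefl _
    intro v
    induction v using hwf.induction with
    | _ v ih =>
      by_contra hv
      exact hnot v ⟨hv, fun u hu => ih u (Relation.TransGen.single hu)⟩

theorem topo_spec (hI : I.IsDAG) : ∃ o : List (Fin I.n),
    topo I.raw = o.map Fin.val ∧ I.IsTopo o ∧ ∀ v, v ∈ o := by
  -- Only the length of `l` matters, as a number of rounds. Each round lists a new vertex unless all
  -- are listed, so `n` rounds suffice.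
  have key : ∀ l : List ℕ, ∃ o : List (Fin I.n),
      l.foldl (fun L _ => (nextVert I.raw L).elim L fun v => L ++ [v]) [] =
        o.map Fin.val ∧ I.IsTopo o ∧ ((∀ v, v ∈ o) ∨ o.length = l.length) := by
    intro l
    induction l using List.reverseRecOn with
    | nil => exact ⟨[], rfl, IsTopo.nil, Or.inr rfl⟩
    | append_singleton l a ih =>
      obtain ⟨o, ho, htopo, hlen⟩ := ih
      rw [List.foldl_append, ho]
      rcases nextVert_spec hI o with ⟨v, h1, h2, h3⟩ | ⟨h1, h2⟩
      · refine ⟨o ++ [v], ?_, IsTopo.snoc htopo h2 h3, Or.inr ?_⟩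
        · simp [h1]
        · rcases hlen with h | h
          · exact (h2 (h v)).elim
          · simp [h]
      · exact ⟨o, by simp [h1], htopo, Or.inl h2⟩
  obtain ⟨o, h1, h2, h3⟩ := key (verts I.raw)
  refine ⟨o, h1, h2, ?_⟩
  rcases h3 with h | h
  · exact h
  · have : o.toFinset = Finset.univ := by
      refine Finset.eq_univ_of_card _ ?_
      rw [List.toFinset_card_of_nodup h2.nodup, h]
      simp [verts, length_raw]
    intro v
    rw [← List.mem_toFinset, this]
    simp

/-- Stored arcs enter treated vertices only, so the next vertex `v` is not yet in the tree and the
move attaches it as a leaf. -/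
theorem lookup_table_sound {o : List (Fin I.n)} (ho : I.IsTopo o) {k : ℕ} {y : List (Fin I.n)}
    (hy : y.length ≤ k) {A : List (ℕ × ℕ)}
    (h : lookup (table I.raw k (o.map Fin.val)) (y.map Fin.val) = some A) :
    ∃ B : List (Fin I.n × Fin I.n), A = vals B ∧ I.IsCertificate y B.toFinset ∧
      ∀ a ∈ B, a.2 ∈ o := by
  induction ho generalizing y A with
  | nil =>
    rw [List.map_nil, table, List.foldl_nil, tableInit, lookup_map _ (I.mem_states_raw y hy)] at h
    cases hall : (y.map Fin.val).all fun v => isRoot I.raw v with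
    | false => simp [hall] at h
    | true =>
      simp only [hall, cond_true, Option.some.injEq] at h
      subst h
      refine ⟨[], rfl, ⟨⟨by simp, by simp, by simp, by simp⟩, fun t ht => ?_, by simp⟩, by simp⟩
      have := List.all_eq_true.1 hall t (List.mem_map_of_mem ht)
      rw [isRoot_raw, decide_eq_true_iff] at this
      rw [this]
      exact Relation.ReflTransGen.refl
  | @snoc o v htopo hv hpred ih =>
    rw [List.map_append, List.map_singleton, lookup_table_append (I.mem_states_raw y hy),
      contains_map, isRoot_raw] at h
    cases hc : decide (v = I.root) || !decide (v ∈ y) with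
    | true =>
      rw [hc, cond_true] at h
      obtain ⟨B, h1, h2, h3⟩ := ih hy h
      exact ⟨B, h1, h2, fun a ha => List.mem_append_left _ (h3 a ha)⟩
    | false =>
      rw [hc, cond_false] at h
      simp only [Bool.or_eq_false_iff, decide_eq_false_iff_not, Bool.not_eq_false',
        decide_eq_true_iff] at hc
      obtain ⟨u, hu, c, hc1, hc2, A', hA', rfl⟩ := mem_move_iff.1 (best_mem h)
      rw [length_raw] at hu
      lift u to Fin I.n using hu
      rw [entry_raw] at hc1
      split_ifs at hc1 with hadj
      rw [Option.some.injEq] at hc1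
      subst hc1
      rw [mapVal_move] at hA'
      obtain ⟨B, rfl, h2, h3⟩ := ih (by simpa using hy) hA'
      rw [numTerm_raw, count_map, List.length_map, bval_bits] at hc2
      have huo := hpred u hadj
      have huv : u ≠ v := fun h => hv (h ▸ huo)
      refine ⟨(u, v) :: B, rfl, ?_, ?_⟩
      · rw [List.toFinset_cons]
        refine h2.insert_arc huv (fun a ha => ⟨?_, ?_⟩) hadj hc.1 ?_ hc2
        · rintro rfl
          exact hv (htopo.mem_of_adj (h2.tree.adj a ha) (h3 a (by simpa using ha)))
        · rintro rfl
          exact hv (h3 a (by simpa using ha))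
        -- Some token is at `v` and moves to `u`, so the smaller certificate reaches `u`.
        · exact h2.linked u (List.mem_map.2 ⟨v, hc.2, by simp⟩)
      · intro a ha
        rcases List.mem_cons.1 ha with rfl | ha
        · simp
        · exact List.mem_append_left _ (h3 a ha)

/-- The predecessors of a listed vertex are listed, so no remaining arc leaves `v`: it is a leaf and
can be removed. -/
theorem exists_erase_leaf {o : List (Fin I.n)} (ho : I.IsTopo o) {v : Fin I.n} (hv : v ∉ o)
    (hpred : ∀ u, I.G.Adj u v → u ∈ o) {y : List (Fin I.n)} {S : Finset (Fin I.n × Fin I.n)}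
    (hS : I.IsCertificate y S) (hSo : ∀ a ∈ S, a.2 ∈ o ++ [v]) {u : Fin I.n} (hu : (u, v) ∈ S) :
    I.IsCertificate (y.map fun z => if z = v then u else z) (S.erase (u, v)) ∧
      (∀ a ∈ S.erase (u, v), a.2 ∈ o) ∧ I.G.Adj u v ∧
      I.terminals.card + y.count v ≤ y.length + I.cap u v := by
  have h1 : ∀ a ∈ S.erase (u, v), a.2 ≠ v := by
    intro a ha h
    rw [Finset.mem_erase] at ha
    exact ha.1 (hS.tree.unique_entry a ha.2 _ hu h)
  have h2 : ∀ a ∈ S.erase (u, v), a.2 ∈ o := by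
    intro a ha
    rcases List.mem_append.1 (hSo a (Finset.mem_of_mem_erase ha)) with h | h
    · exact h
    · exact (h1 a ha (List.mem_singleton.1 h)).elim
  have huv : u ≠ v := fun h => hv (h ▸ hpred u (hS.tree.adj _ hu))
  have h3 : ∀ a ∈ S.erase (u, v), a.1 ≠ v ∧ a.2 ≠ v := by
    refine fun a ha => ⟨?_, h1 a ha⟩
    rintro rfl
    exact hv (ho.mem_of_adj (hS.tree.adj a (Finset.mem_of_mem_erase ha)) (h2 a ha))
  rw [← Finset.insert_erase hu] at hS
  have := hS.of_insert_arc huv h3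
  exact ⟨this.1, h2, this.2⟩

/-- Peeling off the last vertex of the order inverts a step of the table. Inductively, the stored
solution competes with `S` minus its arc into that vertex. -/
theorem lookup_table_complete {o : List (Fin I.n)} (ho : I.IsTopo o) {k : ℕ}
    {y : List (Fin I.n)} (hy : y.length ≤ k) {S : Finset (Fin I.n × Fin I.n)}
    (hS : I.IsCertificate y S) (hSo : ∀ a ∈ S, a.2 ∈ o) :
    ∃ A, lookup (table I.raw k (o.map Fin.val)) (y.map Fin.val) = some A ∧
      weight I.raw A ≤ I.length S := by
  induction ho generalizing y S with
  | nil =>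
    have hS0 : S = ∅ := Finset.eq_empty_of_forall_notMem fun a ha => by simpa using hSo a ha
    subst hS0
    refine ⟨[], ?_, by simp [weight, cost, bval]⟩
    rw [List.map_nil, table, List.foldl_nil, tableInit, lookup_map _ (I.mem_states_raw y hy)]
    have : ((y.map Fin.val).all fun v => isRoot I.raw v) = true := by
      rw [List.all_eq_true]
      intro z hz
      obtain ⟨t, ht, rfl⟩ := List.mem_map.1 hz
      rw [isRoot_raw, decide_eq_true_iff]
      rcases Relation.ReflTransGen.cases_tail (hS.linked t ht) with h | ⟨u, -, h⟩
      · exact h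
      · simp at h
    rw [this, cond_true]
  | @snoc o v htopo hv hpred ih =>
    rw [List.map_append, List.map_singleton, lookup_table_append (I.mem_states_raw y hy),
      contains_map, isRoot_raw]
    cases hc : decide (v = I.root) || !decide (v ∈ y) with
    | true =>
      rw [cond_true]
      -- An arc into a leaf without tokens is useless: dropping it leaves a certificate of no
      -- greater length.
      by_cases hex : ∃ u, (u, v) ∈ S
      · obtain ⟨u, hu⟩ := hex
        obtain ⟨h1, h2, -⟩ := exists_erase_leaf htopo hv hpred hS hSo hu
        have hvy : v ∉ y := by
          have := hS.tree.root_no_entry _ hu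
          simpa [this] using hc
        have hmap : (y.map fun z => if z = v then u else z) = y := by
          conv_rhs => rw [← List.map_id y]
          refine List.map_congr_left fun z hz => ?_
          rw [if_neg]
          · rfl
          · rintro rfl
            exact hvy hz
        rw [hmap] at h1
        obtain ⟨A, hA, hw⟩ := ih hy h1 h2
        exact ⟨A, hA, hw.trans (Finset.sum_le_sum_of_subset (Finset.erase_subset _ _))⟩
      · refine ih hy hS fun a ha => ?_
        rcases List.mem_append.1 (hSo a ha) with h | h
        · exact h
        · rw [List.mem_singleton] at h
          exact (hex ⟨a.1, h ▸ ha⟩).elim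
    | false =>
      rw [cond_false]
      simp only [Bool.or_eq_false_iff, decide_eq_false_iff_not, Bool.not_eq_false',
        decide_eq_true_iff] at hc
      have hex : ∃ u, (u, v) ∈ S := by
        rcases Relation.ReflTransGen.cases_tail (hS.linked v hc.2) with h | ⟨u, -, h⟩
        · exact (hc.1 h).elim
        · exact ⟨u, h⟩
      obtain ⟨u, hu⟩ := hex
      obtain ⟨h1, h2, hadj, hcap⟩ := exists_erase_leaf htopo hv hpred hS hSo hu
      obtain ⟨A, hA, hw⟩ := ih (by simpa using hy) h1 h2
      obtain ⟨B, rfl, hB, -⟩ := lookup_table_sound htopo (by simpa using hy) hA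
      -- All candidates consist of genuine arcs by soundness, so their denominators are nonzero and
      -- `best_le` applies.
      have hgood : ∀ C ∈ move I.raw (table I.raw k (o.map Fin.val))
          (y.map Fin.val) v, bval (cost I.raw C).2 ≠ 0 := by
        intro C hC
        obtain ⟨u, hu, c, hc1, -, A', hA', rfl⟩ := mem_move_iff.1 hC
        rw [length_raw] at hu
        lift u to Fin I.n using hu
        rw [entry_raw] at hc1
        split_ifs at hc1 with hadj
        rw [mapVal_move] at hA'
        obtain ⟨B, rfl, h2, -⟩ := lookup_table_sound htopo (by simpa using hy) hA'
        refine (I.weight_vals ((u, v) :: B) fun a ha => ?_).1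
        rcases List.mem_cons.1 ha with rfl | ha
        · exact hadj
        · exact h2.tree.adj a (by simpa using ha)
      have hmem : ((u : ℕ), (v : ℕ)) :: vals B ∈ move I.raw
          (table I.raw k (o.map Fin.val)) (y.map Fin.val) v := by
        refine mem_move_iff.2 ⟨u, by simp [length_raw], _, by rw [entry_raw, if_pos hadj], ?_,
          vals B, by rwa [mapVal_move], rfl⟩
        rwa [numTerm_raw, count_map, List.length_map, bval_bits]
      obtain ⟨C, hC, hCw⟩ := best_le hgood hmem
      refine ⟨C, hC, hCw.trans ?_⟩
      have hBadj : ∀ a ∈ B, I.G.Adj a.1 a.2 := fun a ha => hB.tree.adj a (by simpa using ha)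
      have e1 := (I.weight_vals ((u, v) :: B) fun a ha => by
        rcases List.mem_cons.1 ha with rfl | ha
        exacts [hadj, hBadj a ha]).2
      rw [(I.weight_vals B hBadj).2] at hw
      change weight I.raw (vals ((u, v) :: B)) ≤ _
      rw [e1, List.map_cons, List.sum_cons]
      rw [SteinerInstance.length, ← Finset.add_sum_erase _ _ hu]
      exact add_le_add le_rfl hw

theorem isSeed_raw_iff {κ : ℕ} (y : List (Fin I.n)) :
    isSeed I.raw κ (y.map Fin.val) = true ↔ I.IsSeedList κ y := by
  have h1 : ((y.map Fin.val).all fun v =>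
      (y.map Fin.val).count v == 1 && isTerm I.raw v) = true ↔
      y.Nodup ∧ ∀ t ∈ y, t ∈ I.terminals := by
    simp only [List.all_map, List.all_eq_true, Function.comp_apply, count_map, isTerm_raw,
      Bool.and_eq_true, beq_iff_eq, decide_eq_true_iff, List.nodup_iff_count_eq_one]
    exact forall₂_and
  rw [isSeed, Bool.and_eq_true, h1, numTerm_raw]
  simp only [Bool.or_eq_true, beq_iff_eq, Nat.sub_eq_zero_iff_le, List.length_map]
  exact ⟨fun h => ⟨h.1.1, h.1.2, h.2⟩, fun h => ⟨⟨h.nodup, h.terminal⟩, h.le_length⟩⟩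

theorem exists_of_mem_candidates {κ : ℕ} (hI : I.IsDAG) {A : List (ℕ × ℕ)}
    (hA : A ∈ ((states I.raw (2 * κ)).filter fun x => isSeed I.raw κ x).flatMap fun x =>
      (lookup (table I.raw (2 * κ) (topo I.raw)) x).toList) :
    ∃ y B, A = vals B ∧ I.IsSeedList κ y ∧ I.IsCertificate y B.toFinset := by
  obtain ⟨o, ho, htopo, -⟩ := topo_spec hI
  rw [List.mem_flatMap] at hA
  obtain ⟨x, hx, hA⟩ := hA
  rw [List.mem_filter] at hx
  obtain ⟨y, rfl, hy⟩ := I.exists_eq_map_of_mem_states hx.1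
  rw [Option.mem_toList, ho] at hA
  obtain ⟨B, rfl, hB, -⟩ := lookup_table_sound htopo hy hA
  exact ⟨y, B, rfl, (isSeed_raw_iff y).1 hx.2, hB⟩

theorem seedTree_sound {κ : ℕ} (hI : I.IsDAG) {A : List (ℕ × ℕ)}
    (hA : seedTree κ I.raw = some A) :
    ∃ y B, A = vals B ∧ I.IsSeedList κ y ∧ I.IsCertificate y B.toFinset :=
  exists_of_mem_candidates hI (best_mem hA)

theorem seedTree_complete {κ : ℕ} (hI : I.IsLargeCapDAG κ) {S : Finset (Fin I.n × Fin I.n)}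
    (hS : I.IsFeasible S) : ∃ A, seedTree κ I.raw = some A ∧ weight I.raw A ≤ I.length S := by
  obtain ⟨y, hseed, hlen, hcert⟩ := hS.exists_certificate hI
  obtain ⟨o, ho, htopo, hall⟩ := topo_spec hI.1
  obtain ⟨A, hA, hw⟩ := lookup_table_complete htopo hlen hcert fun a _ => hall a.2
  have hmem : A ∈ ((states I.raw (2 * κ)).filter fun x => isSeed I.raw κ x).flatMap fun x =>
      (lookup (table I.raw (2 * κ) (topo I.raw)) x).toList := by
    refine List.mem_flatMap.2 ⟨y.map Fin.val, List.mem_filter.2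
      ⟨I.mem_states_raw y hlen, (isSeed_raw_iff y).2 hseed⟩, ?_⟩
    rw [Option.mem_toList, ho, hA]
  obtain ⟨C, hC, hCw⟩ := best_le (fun C hC => by
    obtain ⟨y, B, rfl, -, hB⟩ := exists_of_mem_candidates hI.1 hC
    exact (I.weight_vals B fun a ha => hB.tree.adj a (by simpa using ha)).1) hmem
  exact ⟨C, hC, hCw.trans hw⟩

theorem mergeTrees_raw (B : List (Fin I.n × Fin I.n)) (N : Finset (Fin I.n × Fin I.n)) :
    mergeTrees I.raw (vals B) (arcMatrix N) = arcMatrix (mergeArcs B.toFinset N) := by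
  refine List.ext_getElem (by simp [mergeTrees, verts, length_raw, arcMatrix]) fun u hu hu' => ?_
  refine List.ext_getElem (by simp [mergeTrees, verts, length_raw, arcMatrix]) fun v hv hv' => ?_
  simp only [arcMatrix, List.length_ofFn] at hu'
  lift u to Fin I.n using hu'
  replace hv' : v < I.n := by simpa [arcMatrix] using hv'
  lift v to Fin I.n using hv'
  have h1 : (vals B).contains ((u : ℕ), (v : ℕ)) = decide ((u, v) ∈ B) := by
    rw [Bool.eq_iff_iff]
    simp [vals, Fin.val_inj]
  have h2 : ((vals B).any fun a => a.2 == (v : ℕ)) = decide (∃ a ∈ B, a.2 = v) := by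
    rw [Bool.eq_iff_iff]
    simp [vals, Fin.val_inj]
  have h3 : (((arcMatrix N)[(u : ℕ)]?).bind fun row => row[(v : ℕ)]?).getD false =
      decide ((u, v) ∈ N) := by
    simp [arcMatrix]
  simp only [mergeTrees, verts, List.getElem_map, List.getElem_range, h1, h2, h3]
  rw [Bool.eq_iff_iff]
  simp only [arcMatrix, mergeArcs, Bool.or_eq_true, Bool.and_eq_true, decide_eq_true_eq,
    Bool.not_eq_true', decide_eq_false_iff_not, List.getElem_ofFn, Finset.mem_union,
    Finset.mem_filter, List.mem_toFinset, not_exists, not_and, ne_eq]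

/-- Only an inequality: a list counts repeated arcs repeatedly, and the trees may share arcs. -/
theorem length_mergeArcs_le (B : List (Fin I.n × Fin I.n)) (N : Finset (Fin I.n × Fin I.n)) :
    I.length (mergeArcs B.toFinset N) ≤ (B.map fun a => I.len a.1 a.2).sum + I.length N := by
  have h : ∀ B : List (Fin I.n × Fin I.n),
      I.length B.toFinset ≤ (B.map fun a => I.len a.1 a.2).sum := by
    intro B
    induction B with
    | nil => simp [SteinerInstance.length]
    | cons a B ih =>
      rw [List.toFinset_cons, List.map_cons, List.sum_cons]
      by_cases ha : a ∈ B.toFinset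
      · rw [Finset.insert_eq_of_mem ha]
        exact ih.trans le_add_self
      · rw [SteinerInstance.length, Finset.sum_insert ha]
        exact add_le_add le_rfl ih
  refine le_trans ?_ (add_le_add (h B) le_rfl)
  rw [SteinerInstance.length, SteinerInstance.length, SteinerInstance.length,
    ← Finset.sum_union_inter]
  refine le_trans (Finset.sum_le_sum_of_subset ?_) le_self_add
  exact Finset.union_subset_union le_rfl (Finset.filter_subset _ _)

end MLCapInstance

/-! ### The two problems -/

theorem PT.raw_map {α β : Type} [Enc α] [Enc β] {f : α → β} (hf : PT f) :
    PT fun R : List (List (Option α)) × List Bool × List Bool =>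
      (R.1.map fun row => row.map fun o => o.map f, R.2) := by
  fun_prop

/-- The instance with all lengths equal to zero. -/
def CapInstance.zeroLength (I : CapInstance) : MLCapInstance := { I with len := fun _ _ => 0 }

/-- A certificate merged with any Steiner tree is feasible, and one exists in every directed acyclic
instance, so feasibility is decided without computing it. -/
theorem CapInstance.seedTree_isSome_iff {κ : ℕ} {I : CapInstance} (hI : I.IsLargeCapDAG κ) :
    (seedTree κ I.zeroLength.raw).isSome = true ↔ ∃ S, I.IsFeasible S := by
  constructor
  · intro h
    obtain ⟨A, hA⟩ := Option.isSome_iff_exists.1 h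
    obtain ⟨y, B, -, hy, hB⟩ := MLCapInstance.seedTree_sound (I := I.zeroLength) hI.1 hA
    obtain ⟨N, hN⟩ := RootedNetwork.exists_isSteinerTree hI.1
    exact ⟨_, hB.isFeasible_mergeArcs hI hy hN⟩
  · rintro ⟨S, hS⟩
    obtain ⟨A, hA, -⟩ := MLCapInstance.seedTree_complete (I := I.zeroLength) hI hS
    rw [hA]
    rfl

theorem capSteinerTreePoly (κ : ℕ) : CapSteinerTreePoly fun I => I.IsLargeCapDAG κ := by
  have h : PT fun R : List (List (Option (List Bool))) × List Bool × List Bool =>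
      -- The fraction 0/1 in binary: zero has no digits, one has a single digit.
      (seedTree κ (R.1.map fun row => row.map fun o => o.map fun c => (c, [], [true]),
        R.2)).isSome := by
    fun_prop
  obtain ⟨p, P, hp⟩ := h
  refine ⟨p, P, fun I hI => ?_⟩
  obtain ⟨t, ht, ht'⟩ := hp (I.toRootedNetwork.raw fun u v => (I.cap u v).bits)
  have hraw : I.zeroLength.raw = I.toRootedNetwork.raw fun u v =>
      ((I.cap u v).bits, [], [true]) := by
    simp [MLCapInstance.raw, CapInstance.zeroLength]
  dsimp only at ht ht'
  rw [RootedNetwork.enc_raw, RootedNetwork.raw_map, ← hraw] at ht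
  rw [RootedNetwork.enc_raw] at ht'
  exact ⟨_, t, ht, ht', _, rfl, CapInstance.seedTree_isSome_iff hI⟩

/-- Any feasible `S'` is at least as long as the shortest certificate, and it is also a Steiner
tree, which bounds the length of `N`. The two bounds add up to the factor `1 + ρ`. -/
theorem MLCapInstance.seedTree_elim_correct {κ : ℕ} {ρ : SteinerInstance → ℝ} {I : MLCapInstance}
    (hI : I.IsLargeCapDAG κ) {N : Finset (Fin I.n × Fin I.n)} (hN : I.IsSteinerTree N)
    (hmin : ∀ S', I.IsSteinerTree S' →
      (I.length N : ℝ) ≤ ρ I.toSteinerInstance * (I.length S' : ℝ)) {y : Data}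
    (hy : y = Enc.enc ((seedTree κ I.raw).elim none fun A =>
      some (mergeTrees I.raw A (arcMatrix N)))) :
    (∃ S, y = Data.cons (encArcs S) Data.nil ∧ I.IsFeasible S ∧
      ∀ S', I.IsFeasible S' → (I.length S : ℝ) ≤
        (1 + ρ I.toSteinerInstance) * (I.length S' : ℝ)) ∨
    (y = Data.nil ∧ ¬ ∃ S, I.IsFeasible S) := by
  cases hA : seedTree κ I.raw with
  | none =>
    refine Or.inr ⟨by rw [hy, hA]; rfl, ?_⟩
    rintro ⟨S, hS⟩
    obtain ⟨A, hA', -⟩ := seedTree_complete hI hS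
    simp [hA] at hA'
  | some A =>
    obtain ⟨x, B, rfl, hx, hB⟩ := seedTree_sound hI.1 hA
    refine Or.inl ⟨mergeArcs B.toFinset N, ?_, hB.isFeasible_mergeArcs hI hx hN,
      fun S' hS' => ?_⟩
    · rw [hy, hA, Option.elim_some, mergeTrees_raw, enc_some, enc_arcMatrix]
    · obtain ⟨A', hA', hw⟩ := seedTree_complete hI hS'
      rw [hA, Option.some.injEq] at hA'
      subst hA'
      rw [(I.weight_vals B fun a ha => hB.tree.adj a (by simpa using ha)).2] at hw
      have h1 : I.length (mergeArcs B.toFinset N) ≤ I.length S' + I.length N :=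
        (length_mergeArcs_le B N).trans (add_le_add hw le_rfl)
      have h2 : (I.length (mergeArcs B.toFinset N) : ℝ) ≤ (I.length S' : ℝ) + (I.length N : ℝ) := by
        exact_mod_cast h1
      have h3 := hmin S' hS'.1
      linarith

theorem mlCapSteinerTreeApprox (κ : ℕ) {ρ : SteinerInstance → ℝ}
    (h : SteinerTreeApprox (fun I => I.IsDAG) ρ) :
    MLCapSteinerTreeApprox (fun I => I.IsLargeCapDAG κ) fun I => 1 + ρ I.toSteinerInstance := by
  obtain ⟨q, Q, hq⟩ := h
  let J := {I : MLCapInstance // I.IsLargeCapDAG κ}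
  -- The tree `N` returned for each instance is fixed by choice. It is guaranteed only on acyclic
  -- instances, so the computations below are indexed by the subtype `J`.
  choose! y t hrun ht N hy hN hmin using hq
  have hsteiner : Comp (fun I : J => I.1.toSteinerInstance.enc)
      (fun I => Enc.enc (arcMatrix (N I.1.toSteinerInstance))) := by
    refine ⟨q, Q, fun I => ⟨t I.1.toSteinerInstance, ?_, ht _ I.2.1⟩⟩
    dsimp only
    rw [enc_arcMatrix, ← hy _ I.2.1]
    exact hrun _ I.2.1
  have hconv : Comp (fun I : J => Enc.enc I.1.raw) (fun I : J => I.1.toSteinerInstance.enc) := by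
    have := (PT.raw_map (f := fun c : List Bool × List Bool × List Bool => c.2)
      (by fun_prop)).reindex fun I : J => I.1.raw
    refine this.congr (fun _ => rfl) fun I => ?_
    simp only [Function.comp_apply, MLCapInstance.raw, RootedNetwork.raw_map,
      RootedNetwork.enc_raw]
    rfl
  have hpost : PT fun p : RawNetwork × List (List Bool) =>
      (seedTree κ p.1).elim none fun A => some (mergeTrees p.1 A p.2) := by
    fun_prop
  obtain ⟨p, P, hp⟩ := (Comp.id.cons (hconv.trans hsteiner)).trans
    (hpost.reindex fun I : J => (I.1.raw, arcMatrix (N I.1.toSteinerInstance)))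
  refine ⟨p, P, fun I hI => ?_⟩
  obtain ⟨s, hs, hs'⟩ := hp ⟨I, hI⟩
  dsimp only at hs hs'
  rw [MLCapInstance.enc_raw] at hs hs'
  exact ⟨_, s, hs, hs', MLCapInstance.seedTree_elim_correct hI (hN I.toSteinerInstance hI.1)
    (hmin I.toSteinerInstance hI.1) rfl⟩

end CapSteiner

theorem mainTheorem11 (κ : ℕ) :
    CapSteiner.CapSteinerTreePoly (fun I => I.IsLargeCapDAG κ) ∧
    ∀ ρ : CapSteiner.SteinerInstance → ℝ, (∀ I, 1 ≤ ρ I) →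
      CapSteiner.SteinerTreeApprox (fun I => I.IsDAG) ρ →
      CapSteiner.MLCapSteinerTreeApprox (fun I => I.IsLargeCapDAG κ)
        (fun I => 1 + ρ I.toSteinerInstance) :=
  ⟨CapSteiner.capSteinerTreePoly κ, fun _ _ h => CapSteiner.mlCapSteinerTreeApprox κ h⟩
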